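/- Let $M$ be a smooth (Hausdorff, second countable) manifold and let $\Gamma$ be a set of smooth tensor fields on $M$ of a fixed type $(r,s)$ (or tuples of such of fixed types), invariant under pull-back by $\mathrm{Diff}(M)$ and under positive scalings. Let $\gamma\mapsto q(\gamma)$ assign to each $\gamma\in\Gamma$ a tensor field of the same type such that $q(f^*\gamma)=f^*q(\gamma)$ for all $f\in\mathrm{Diff}(M)$ and $q(c\gamma)=c^{\alpha}q(\gamma)$ for all $c>0$, for some fixed $\alpha<1$. Solutions of the flow $$\tfrac{\partial}{\partial t}\gamma(t)=q(\gamma(t)),\qquad \gamma(0)=\gamma, \qquad (1)$$ are families $\gamma(t)\in\Gamma$, smooth in $(t,p)$, defined for $t$ in an open interval around $0$. Let $\mathrm{Aut}(M,\gamma)=\{f\in\mathrm{Diff}(M):f^*\gamma=\gamma\}$. The pair $(M,\gamma)$ is called homogeneous if $\mathrm{Aut}(M,\gamma)$ acts transitively on $M$, and a soliton if $q(\gamma)=c\gamma+\mathcal L_X\gamma$ for some $c\in\mathbb R$ and some complete vector field $X$ on $M$. Assume that for each homogeneous $\gamma\in\Gamma$ there is a unique solution $\gamma(t)$ of (1) such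 that $(M,\gamma(t))$ is homogeneous for all $t$ (that is, one exists on some open interval around $0$, and any two on the same open interval around $0$ coincide). Let $\gamma\in\Gamma$ be a homogeneous soliton such that $G=\mathrm{Aut}(M,\gamma)$ is a (second countable) Lie group, with the smooth structure for which a family of elements of $G$ parametrized by an open subset of a Euclidean space is smooth if and only if it is a smooth family of diffeomorphisms of $M$. Let $o\in M$, let $K$ be the isotropy subgroup of $G$ at $o$, and let $\mathfrak g$ and $\mathfrak k$ be the Lie algebras of $G$ and $K$. Then $M=G/K$ as a homogeneous space (i.e. the action of $G$ on $M$ is smooth and transitive, and $\pi:G\to M$, $a\mapsto a(o)$, is a submersion, so that $T_oM\equiv\mathfrak g/\mathfrak k$), and $(G/K,\gamma)$ is a semi-algebraic soliton, i.e. there is $c\in\mathbb R$ such that: 1. $q(\gamma)=c\gamma+\theta(D_{\mathfrak p})\gamma$ at $o$, for some derivation $D$ of $\mathfrak g$ with $D\mathfrak k\subset\mathfrak k$, where $D_{\mathfrak p}$ is the operator induced by $D$ on $T_oM\equiv\mathfrak g/\mathfrak k$ and $\theta$ is the natural representation of $\mathfrak{gl}(T_oM)$ on tensors; 2. the equation (1)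 has a $G$-invariant solution of the form $\gamma(t)=c(t)f(t)^*\gamma$ with $c(t)=((1-\alpha)ct+1)^{1/(1-\alpha)}$, for all $t$ with $(1-\alpha)ct+1>0$, where each $f(t)\in\mathrm{Aut}(G/K)$, i.e. $f(t)$ is a diffeomorphism of $M$ defined by an automorphism of the Lie group $G$ taking $K$ onto $K$. -/

import Mathlib

open Set
open scoped Manifold ContDiff

noncomputable section

namespace HomSoliton

/-! ## Tensors on a vector space -/

section LinearAlgebra

variable {V W : Type*} [AddCommGroup V] [Module ℝ V] [AddCommGroup W] [Module ℝ W]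

/-- Tensors of type `(r, s)` on a finite-dimensional real vector space `V`: multilinear maps from
`V × ⋯ × V` (`r` factors) to `V ⊗ ⋯ ⊗ V` (`s` factors), an element of the latter being regarded as
a multilinear form on `s` covectors. -/
abbrev Tensor (r s : ℕ) (V : Type*) [AddCommGroup V] [Module ℝ V] : Type _ :=
  MultilinearMap ℝ (fun _ : Fin r => V)
    (MultilinearMap ℝ (fun _ : Fin s => Module.Dual ℝ V) ℝ)

/-- The pull-back `e^* T` of a tensor on `W` by a linear isomorphism `e : V ≃ W`. -/
def Tensor.pullback {r s : ℕ} (e : V ≃ₗ[ℝ] W) (T : Tensor r s W) : Tensor r s V :=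
  (MultilinearMap.compLinearMapₗ
    (fun _ : Fin s => Module.Dual.transpose (R := ℝ) (e.symm : W →ₗ[ℝ] V))).compMultilinearMap
      (T.compLinearMap fun _ : Fin r => (e : V →ₗ[ℝ] W))

theorem Tensor.pullback_apply {r s : ℕ} (e : V ≃ₗ[ℝ] W) (T : Tensor r s W)
    (v : Fin r → V) (β : Fin s → Module.Dual ℝ V) :
    Tensor.pullback e T v β = T (fun i => e (v i)) (fun j => β j ∘ₗ (e.symm : W →ₗ[ℝ] V)) :=
  rfl

/-- The value at `(v, β)` of `θ(A) T`, where `θ` is the representation of `𝔤𝔩(V)` on tensors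
`θ(A) T = θ_s(A) T - T(A ·, …, ·) - ⋯ - T(·, …, A ·)`. -/
def Tensor.theta {r s : ℕ} (A : V →ₗ[ℝ] V) (T : Tensor r s V)
    (v : Fin r → V) (β : Fin s → Module.Dual ℝ V) : ℝ :=
  (∑ j, T v (Function.update β j (β j ∘ₗ A))) - ∑ i, T (Function.update v i (A (v i))) β

end LinearAlgebra

/-! ## The diffeomorphism group -/

section Diff

variable {E : Type*} [NormedAddCommGroup E] [NormedSpace ℝ E]
  {M : Type*} [TopologicalSpace M] [ChartedSpace E M]

variable (E M) in
/-- The group `Diff(M)` of smooth diffeomorphisms of `M`. -/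
abbrev Diff : Type _ := Diffeomorph 𝓘(ℝ, E) 𝓘(ℝ, E) M M ∞

instance : Group (Diff E M) where
  mul f g := g.trans f
  one := Diffeomorph.refl 𝓘(ℝ, E) M ∞
  inv f := f.symm
  mul_assoc _ _ _ := rfl
  one_mul _ := rfl
  mul_one _ := rfl
  inv_mul_cancel f := Diffeomorph.ext fun x => f.symm_apply_apply x

theorem Diff.mul_apply (f g : Diff E M) (p : M) : (f * g) p = f (g p) := rfl

theorem Diff.one_apply (p : M) : (1 : Diff E M) p = p := rfl

/-! ## Tensor fields -/

variable {ι : Type*} (r s : ι → ℕ)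

variable (E M) in
/-- Tuples, indexed by `ι`, of (not necessarily smooth) tensor fields on `M`, the one with index
`k` being of type `(r k, s k)`. A single tensor field is the case of a one-point `ι`. -/
abbrev TensorField : Type _ :=
  ∀ (p : M) (k : ι), Tensor (r k) (s k) (TangentSpace 𝓘(ℝ, E) p)

variable {r s}

/-- The component of the `k`-th tensor field of `γ` in the local trivialization of the tangent
bundle at `x₀`, for fixed vectors `v` and covectors `β` of the model space, as a function of
the point `p`. -/
def TensorField.component (γ : TensorField E M r s) [IsManifold 𝓘(ℝ, E) ∞ M] (x₀ : M) (k : ι)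
    (v : Fin (r k) → E) (β : Fin (s k) → Module.Dual ℝ E) (p : M) : ℝ :=
  γ p k
    (fun i => (trivializationAt E (TangentSpace 𝓘(ℝ, E)) x₀).symmL ℝ p (v i))
    (fun j => β j ∘ₗ
      ((trivializationAt E (TangentSpace 𝓘(ℝ, E)) x₀).continuousLinearMapAt ℝ p).toLinearMap)

/-- A smooth (tuple of) tensor field(s): all components in all local trivializations of the
tangent bundle are smooth. -/
def TensorField.IsSmooth [IsManifold 𝓘(ℝ, E) ∞ M] (γ : TensorField E M r s) : Prop :=
  ∀ (x₀ : M) (k : ι) (v : Fin (r k) → E) (β : Fin (s k) → Module.Dual ℝ E),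
    ContMDiffOn 𝓘(ℝ, E) 𝓘(ℝ, ℝ) ∞ (γ.component x₀ k v β)
      (trivializationAt E (TangentSpace 𝓘(ℝ, E)) x₀).baseSet

/-- A one-parameter family `γ t`, `t ∈ J`, of tensor fields depending smoothly on `(t, p)`. -/
def TensorField.IsSmoothFamily [IsManifold 𝓘(ℝ, E) ∞ M] (J : Set ℝ)
    (γ : ℝ → TensorField E M r s) : Prop :=
  ∀ (x₀ : M) (k : ι) (v : Fin (r k) → E) (β : Fin (s k) → Module.Dual ℝ E),
    ContMDiffOn (𝓘(ℝ, ℝ).prod 𝓘(ℝ, E)) 𝓘(ℝ, ℝ) ∞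
      (fun z : ℝ × M => (γ z.1).component x₀ k v β z.2)
      (J ×ˢ (trivializationAt E (TangentSpace 𝓘(ℝ, E)) x₀).baseSet)

/-- The differential `df|_p : T_p M → T_{f(p)} M` of a diffeomorphism. -/
def Diff.tangentEquiv (f : Diff E M) (p : M) :
    TangentSpace 𝓘(ℝ, E) p ≃ₗ[ℝ] TangentSpace 𝓘(ℝ, E) (f p) :=
  (f.mfderivToContinuousLinearEquiv (by simp) p).toLinearEquiv

theorem Diff.tangentEquiv_apply (f : Diff E M) (p : M) (v : TangentSpace 𝓘(ℝ, E) p) :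
    f.tangentEquiv p v = mfderiv 𝓘(ℝ, E) 𝓘(ℝ, E) f p v := rfl

/-- The pull-back `f^* γ` of tensor fields by a diffeomorphism. -/
def TensorField.pullback (f : Diff E M) (γ : TensorField E M r s) : TensorField E M r s :=
  fun p k => Tensor.pullback (Diff.tangentEquiv f p) (γ (f p) k)

theorem Diff.tangentEquiv_mul (f g : Diff E M) (p : M) :
    (f * g).tangentEquiv p = (g.tangentEquiv p).trans (f.tangentEquiv (g p)) := by
  apply LinearEquiv.ext
  intro v
  have hf : MDifferentiableAt 𝓘(ℝ, E) 𝓘(ℝ, E) f (g p) :=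
    f.contMDiff.mdifferentiableAt (by simp)
  have hg : MDifferentiableAt 𝓘(ℝ, E) 𝓘(ℝ, E) g p :=
    g.contMDiff.mdifferentiableAt (by simp)
  exact congrArg (fun L => L v) (mfderiv_comp p hf hg)

theorem Diff.tangentEquiv_one (p : M) :
    (1 : Diff E M).tangentEquiv p = LinearEquiv.refl ℝ (TangentSpace 𝓘(ℝ, E) p) := by
  apply LinearEquiv.ext
  intro v
  exact congrArg (fun L => L v) (mfderiv_id (I := 𝓘(ℝ, E)) (x := p))

theorem TensorField.pullback_mul (f g : Diff E M) (γ : TensorField E M r s) :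
    γ.pullback (f * g) = (γ.pullback f).pullback g := by
  funext p k
  change Tensor.pullback ((f * g).tangentEquiv p) (γ (f (g p)) k) =
    Tensor.pullback (g.tangentEquiv p) (Tensor.pullback (f.tangentEquiv (g p)) (γ (f (g p)) k))
  rw [Diff.tangentEquiv_mul]
  rfl

theorem TensorField.pullback_one (γ : TensorField E M r s) :
    γ.pullback (1 : Diff E M) = γ := by
  funext p k
  change Tensor.pullback ((1 : Diff E M).tangentEquiv p) (γ p k) = γ p k
  rw [Diff.tangentEquiv_one]
  rfl

/-- The automorphism group `Aut(M, γ) = {f ∈ Diff(M) : f^* γ = γ}`. -/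
def autGroup (γ : TensorField E M r s) : Subgroup (Diff E M) where
  carrier := {f | γ.pullback f = γ}
  one_mem' := γ.pullback_one
  mul_mem' {f g} hf hg := by
    change γ.pullback (f * g) = γ
    rw [TensorField.pullback_mul, show γ.pullback f = γ from hf, show γ.pullback g = γ from hg]
  inv_mem' {f} hf := by
    change γ.pullback f⁻¹ = γ
    conv_lhs => rw [← show γ.pullback f = γ from hf]
    rw [← TensorField.pullback_mul, mul_inv_cancel, TensorField.pullback_one]

/-- `(M, γ)` is homogeneous: `Aut(M, γ)` acts transitively on `M`. -/
def IsHomogeneous (γ : TensorField E M r s) : Prop :=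
  ∀ p p' : M, ∃ f ∈ autGroup γ, f p = p'

/-- `X` is a (smooth) complete vector field on `M` with flow `φ`. -/
structure IsCompleteFlow [IsManifold 𝓘(ℝ, E) ∞ M]
    (X : ∀ p : M, TangentSpace 𝓘(ℝ, E) p) (φ : ℝ → Diff E M) : Prop where
  smooth_field : ContMDiff 𝓘(ℝ, E) 𝓘(ℝ, E).tangent ∞
    (fun p => (⟨p, X p⟩ : TangentBundle 𝓘(ℝ, E) M))
  map_zero : φ 0 = 1
  map_add : ∀ t u, φ (t + u) = φ t * φ u
  smooth : ContMDiff (𝓘(ℝ, ℝ).prod 𝓘(ℝ, E)) 𝓘(ℝ, E) ∞ (fun z : ℝ × M => φ z.1 z.2)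
  integralCurve : ∀ p : M, IsMIntegralCurve (I := 𝓘(ℝ, E)) (fun t => φ t p) X

/-- `L` is the Lie derivative of `γ` along the vector field with flow `φ`:
`L = d/dt|_{t = 0} φ_t^* γ`. -/
def HasLieDerivative (φ : ℝ → Diff E M) (γ L : TensorField E M r s) : Prop :=
  ∀ (p : M) (k : ι) (v : Fin (r k) → TangentSpace 𝓘(ℝ, E) p)
    (β : Fin (s k) → Module.Dual ℝ (TangentSpace 𝓘(ℝ, E) p)),
    HasDerivAt (fun t => γ.pullback (φ t) p k v β) (L p k v β) 0

end Diff

/-! ## Geometric flows and solitons -/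

section Flow

variable {E : Type*} [NormedAddCommGroup E] [NormedSpace ℝ E]
  {M : Type*} [TopologicalSpace M] [ChartedSpace E M] [IsManifold 𝓘(ℝ, E) ∞ M]
  {ι : Type*} {r s : ι → ℕ}

variable (E M r s) in
/-- A space `Γ` of geometric structures (smooth tensor fields of a fixed type) on `M`, invariant
under diffeomorphisms and positive scalings, with a preferred direction `q` on it that is
diffeomorphism equivariant and satisfies `q(cγ) = c^α q(γ)` for a fixed `α < 1`.
The values of `q` outside `Γ` play no role. -/
structure GeometricFlow where
  Γ : Set (TensorField E M r s)
  q : TensorField E M r s → TensorField E M r s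
  α : ℝ
  smooth : ∀ γ ∈ Γ, γ.IsSmooth
  pullback_mem : ∀ γ ∈ Γ, ∀ f : Diff E M, γ.pullback f ∈ Γ
  smul_mem : ∀ γ ∈ Γ, ∀ c : ℝ, 0 < c → c • γ ∈ Γ
  equivariant : ∀ γ ∈ Γ, ∀ f : Diff E M, q (γ.pullback f) = (q γ).pullback f
  scaling : ∀ γ ∈ Γ, ∀ c : ℝ, 0 < c → q (c • γ) = c ^ α • q γ
  α_lt_one : α < 1

namespace GeometricFlow

variable (Φ : GeometricFlow E M r s)

/-- `γt t`, `t ∈ J`, is a smooth solution in `Γ` of `∂/∂t γ(t) = q(γ(t))`, `γ(0) = γ`, on the open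
interval `J` containing `0`. (The values of `γt` outside `J` play no role.) -/
structure IsSolution (J : Set ℝ) (γt : ℝ → TensorField E M r s) (γ : TensorField E M r s) :
    Prop where
  isOpen : IsOpen J
  ordConnected : J.OrdConnected
  zero_mem : (0 : ℝ) ∈ J
  initial : γt 0 = γ
  mem : ∀ t ∈ J, γt t ∈ Φ.Γ
  smooth : TensorField.IsSmoothFamily J γt
  hasDeriv : ∀ t ∈ J, ∀ (p : M) (k : ι) (v : Fin (r k) → TangentSpace 𝓘(ℝ, E) p)
    (β : Fin (s k) → Module.Dual ℝ (TangentSpace 𝓘(ℝ, E) p)),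
    HasDerivAt (fun u => γt u p k v β) (Φ.q (γt t) p k v β) t

/-- A solution `γt` such that `(M, γt t)` is homogeneous for all `t`. -/
def IsHomogeneousSolution (J : Set ℝ) (γt : ℝ → TensorField E M r s)
    (γ : TensorField E M r s) : Prop :=
  Φ.IsSolution J γt γ ∧ ∀ t ∈ J, IsHomogeneous (γt t)

/-- For each homogeneous `γ ∈ Γ` there is a unique solution starting at `γ` that is homogeneous
for all times: one exists on some open interval around `0`, and any two defined on the same
interval agree. -/
def HasUniqueHomogeneousSolutions : Prop :=
  ∀ γ ∈ Φ.Γ, IsHomogeneous γ →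
    (∃ J γt, Φ.IsHomogeneousSolution J γt γ) ∧
    ∀ J γt γt', Φ.IsHomogeneousSolution J γt γ → Φ.IsHomogeneousSolution J γt' γ →
      EqOn γt γt' J

/-- `γ` is a soliton: `q(γ) = c γ + L_X γ` for some `c ∈ ℝ` and some complete vector field `X`. -/
def IsSoliton (γ : TensorField E M r s) : Prop :=
  ∃ (c : ℝ) (X : ∀ p : M, TangentSpace 𝓘(ℝ, E) p) (φ : ℝ → Diff E M)
    (L : TensorField E M r s),
    IsCompleteFlow X φ ∧ HasLieDerivative φ γ L ∧ Φ.q γ = c • γ + L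

end GeometricFlow

end Flow

/-! ## Homogeneous spaces -/

section HomogeneousSpace

variable {E : Type*} [NormedAddCommGroup E] [NormedSpace ℝ E]
  {M : Type*} [TopologicalSpace M] [ChartedSpace E M]
  {F : Type*} [NormedAddCommGroup F] [NormedSpace ℝ F]
  {G : Type*} [Group G] [TopologicalSpace G] [ChartedSpace F G]

/-- The isotropy subgroup `K` at the origin `o` of an action `τ` of `G` on `M` by
diffeomorphisms. -/
def isotropy (τ : G →* Diff E M) (o : M) : Subgroup G where
  carrier := {a | τ a o = o}
  one_mem' := by
    change τ 1 o = o
    rw [map_one]; rfl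
  mul_mem' {a b} ha hb := by
    change τ (a * b) o = o
    rw [map_mul, Diff.mul_apply, show τ b o = o from hb, show τ a o = o from ha]
  inv_mem' {a} ha := by
    change τ a⁻¹ o = o
    conv_lhs => rw [← show τ a o = o from ha]
    rw [← Diff.mul_apply, ← map_mul, inv_mul_cancel, map_one]; rfl

/-- `f ∈ Aut(G/K)`: the diffeomorphism `f` of `M = G/K` is given by an automorphism `ψ` of the Lie
group `G` taking `K` onto `K`, that is, `f(a · o) = ψ(a) · o` for all `a ∈ G`. -/
def IsEquivariantDiffeo (τ : G →* Diff E M) (o : M) (f : Diff E M) : Prop :=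
  ∃ ψ : G ≃* G, ContMDiff 𝓘(ℝ, F) 𝓘(ℝ, F) ∞ ψ ∧ ContMDiff 𝓘(ℝ, F) 𝓘(ℝ, F) ∞ ψ.symm ∧
    (isotropy τ o).map ψ.toMonoidHom = isotropy τ o ∧ ∀ a : G, f (τ a o) = τ (ψ a) o

/-- The differential at the identity of the projection `π : G → G/K = M`, `a ↦ a · o`, from the
Lie algebra `𝔤` of `G` to `T_o M`. When `π` is a submersion it induces the identification of
`𝔤/𝔨` with `T_o M`. -/
def projDeriv (τ : G →* Diff E M) (o : M) :
    GroupLieAlgebra 𝓘(ℝ, F) G →ₗ[ℝ] TangentSpace 𝓘(ℝ, E) o :=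
  (mfderiv 𝓘(ℝ, F) 𝓘(ℝ, E) (fun a : G => τ a o) 1).toLinearMap

/-- The Lie algebra `𝔨 = Ker dπ|_e` of the isotropy subgroup `K`. -/
def isotropyAlgebra (τ : G →* Diff E M) (o : M) :
    Submodule ℝ (GroupLieAlgebra 𝓘(ℝ, F) G) :=
  LinearMap.ker (projDeriv τ o)

/-- `D ∈ Der(𝔤/𝔨)`: `D` is a derivation of the Lie algebra `𝔤` with `D 𝔨 ⊆ 𝔨`. -/
def IsDerivationPair (τ : G →* Diff E M) (o : M)
    (D : GroupLieAlgebra 𝓘(ℝ, F) G →ₗ[ℝ] GroupLieAlgebra 𝓘(ℝ, F) G) : Prop :=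
  (∀ Y Z, D ⁅Y, Z⁆ = ⁅D Y, Z⁆ + ⁅Y, D Z⁆) ∧ ∀ Z ∈ isotropyAlgebra τ o, D Z ∈ isotropyAlgebra τ o

/-- The action `τ` of the Lie group `G` on `M` presents `M` as the homogeneous space `G/K`, `K` the
isotropy subgroup at `o`: the action is smooth and transitive and `a ↦ a · o` is a submersion
(at the identity, hence everywhere by equivariance). -/
structure IsPresentation (τ : G →* Diff E M) (o : M) : Prop where
  smooth : ContMDiff (𝓘(ℝ, F).prod 𝓘(ℝ, E)) 𝓘(ℝ, E) ∞ (fun z : G × M => τ z.1 z.2)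
  transitive : ∀ p : M, ∃ a : G, τ a o = p
  submersion : Function.Surjective (projDeriv (F := F) τ o)

/-- A manifold structure on a group `H` of diffeomorphisms of `M` that is compatible with the
smooth structure of `Diff(M)`: a family of elements of `H` parametrized by an open subset of a
Euclidean space is smooth as a map to `H` exactly when it is a smooth family of diffeomorphisms.
The first condition is smoothness of the action, i.e. one half of this equivalence; both
together determine the manifold structure of `H`. -/
structure IsLieTransformationGroup (H : Subgroup (Diff E M)) [TopologicalSpace H]
    [ChartedSpace F H] : Prop where
  smooth_action : ContMDiff (𝓘(ℝ, F).prod 𝓘(ℝ, E)) 𝓘(ℝ, E) ∞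
    (fun z : H × M => (z.1 : Diff E M) z.2)
  smooth_of_family : ∀ (n : ℕ) (U : Set (EuclideanSpace ℝ (Fin n))) (h : EuclideanSpace ℝ (Fin n) → H),
    IsOpen U →
    ContMDiffOn (𝓘(ℝ, EuclideanSpace ℝ (Fin n)).prod 𝓘(ℝ, E)) 𝓘(ℝ, E) ∞
      (fun z : EuclideanSpace ℝ (Fin n) × M => (h z.1 : Diff E M) z.2) (U ×ˢ univ) →
    ContMDiffOn 𝓘(ℝ, EuclideanSpace ℝ (Fin n)) 𝓘(ℝ, F) ∞ h U

end HomogeneousSpace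

/-! ## Semi-algebraic solitons -/

namespace GeometricFlow

variable {E : Type*} [NormedAddCommGroup E] [NormedSpace ℝ E]
  {M : Type*} [TopologicalSpace M] [ChartedSpace E M] [IsManifold 𝓘(ℝ, E) ∞ M]
  {ι : Type*} {r s : ι → ℕ} (Φ : GeometricFlow E M r s)

/-- The scaling `c(t) = ((1 - α) c t + 1)^{1 / (1 - α)}` of a self-similar solution. -/
def scale (c t : ℝ) : ℝ := ((1 - Φ.α) * c * t + 1) ^ (1 / (1 - Φ.α))

/-- The time interval of a self-similar solution: `(-T_α, ∞)`, `(-∞, ∞)` or `(-∞, T_α)` if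
`c > 0`, `c = 0` or `c < 0` respectively, where `T_α = 1 / ((1 - α) |c|)`. -/
def scaleInterval (c : ℝ) : Set ℝ := {t | 0 < (1 - Φ.α) * c * t + 1}

variable {F : Type*} [NormedAddCommGroup F] [NormedSpace ℝ F]
  {G : Type*} [Group G] [TopologicalSpace G] [ChartedSpace F G]

/-- The algebraic soliton equation for `(G/K, γ)`: `q(γ) = c γ + θ(D_𝔭) γ` at the origin for some
`D ∈ Der(𝔤/𝔨)`, where `D_𝔭 = A` is the operator induced by `D` on `T_o M = 𝔤/𝔨`. -/
def SatisfiesAlgebraicEquation (τ : G →* Diff E M) (o : M) (γ : TensorField E M r s)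
    (c : ℝ) : Prop :=
  ∃ (D : GroupLieAlgebra 𝓘(ℝ, F) G →ₗ[ℝ] GroupLieAlgebra 𝓘(ℝ, F) G)
    (A : TangentSpace 𝓘(ℝ, E) o →ₗ[ℝ] TangentSpace 𝓘(ℝ, E) o),
    IsDerivationPair τ o D ∧ (∀ Z, A (projDeriv τ o Z) = projDeriv τ o (D Z)) ∧
    ∀ k v β, Φ.q γ o k v β = c * γ o k v β + Tensor.theta A (γ o k) v β

/-- The `G`-invariant solution starting at `γ` is self-similar relative to equivariant
equivalence: it is `γ(t) = c(t) f(t)^* γ` with `f(t) ∈ Aut(G/K)`. -/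
def EvolvesEquivariantly (τ : G →* Diff E M) (o : M) (γ : TensorField E M r s)
    (c : ℝ) : Prop :=
  ∃ (γt : ℝ → TensorField E M r s) (f : ℝ → Diff E M),
    Φ.IsSolution (Φ.scaleInterval c) γt γ ∧
    ∀ t ∈ Φ.scaleInterval c,
      (∀ a : G, (γt t).pullback (τ a) = γt t) ∧
      IsEquivariantDiffeo (F := F) τ o (f t) ∧
      γt t = Φ.scale c t • γ.pullback (f t)

/-- `(G/K, γ)` is a semi-algebraic soliton. Both descriptions are required, with a common constant
`c`: self-similarity of the evolution relative to `Aut(G/K)`, and its infinitesimal version; they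
are known to be equivalent when `G` is simply connected and `K` is connected, which is not
assumed here. -/
def IsSemiAlgebraicSoliton (τ : G →* Diff E M) (o : M) (γ : TensorField E M r s) : Prop :=
  ∃ c : ℝ, Φ.SatisfiesAlgebraicEquation (F := F) τ o γ c ∧
    Φ.EvolvesEquivariantly (F := F) τ o γ c

end GeometricFlow

end HomSoliton

end

noncomputable section

namespace HomSoliton

open Filter Topology Bundle VectorField

/-! ### Evaluation of tensors at varying vectors and covectors. -/

section TensorCalculus

/-! The soliton equation integrates to the self-similar solution c(t) φ_{s(t)}^* γ, where φ is the
flow of the soliton field and s(t) is `time`. For a in G = Aut(M, γ), the pull-back of this solution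
by a is again a solution through γ, homogeneous at all times, so uniqueness makes the two equal.
Hence G preserves every φ_u^* γ, which says that every φ_u normalizes G
(`conj_mem_autGroup_of_soliton`).

By transitivity some b_u in G brings φ_u(o) back to o. Then f_u = b_u φ_u fixes o, still normalizes
G, and satisfies f_u^* γ = φ_u^* γ because b_u^* γ = γ. Conjugation by f_u is an automorphism of G
that preserves K and induces f_u on G/K; this gives the equivariant evolution
(`isEquivariantDiffeo_mul`). If b_u is smooth near u = 0 with b_0 = 1, the differentials of these
automorphisms at the identity preserve the bracket, so their derivative at u = 0 is a derivation of
𝔤, and dπ intertwines it with the derivative of df_u at o. As L_X γ is the derivative of f_u^* γ, it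
equals at o the action through θ of minus that last operator; this is the algebraic equation
(`exists_derivation_of_normalizing_flow`).

A smooth b_u comes from a local section of the orbit map, which must therefore be a submersion
(`surjective_modelDeriv_orbit`). Its rank is constant by equivariance. Were it less than dim M,
small compact sets of G would have orbits of Hausdorff dimension less than dim M, hence without
interior; countably many translates of one of them cover M, against Baire. Smoothness of (u, a) ↦
φ_u a φ_u⁻¹ comes from the condition that characterizes the smooth structure of G by smooth families
(`contMDiff_conjFamily`). -/

theorem multilinear_eq_sum_basis {κ n W : Type*} [Fintype n] [DecidableEq n] [Fintype κ]
    [AddCommGroup W]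
    [Module ℝ W] (b : Module.Basis κ ℝ W) (f : MultilinearMap ℝ (fun _ : n => W) ℝ) (z : n → W) :
    f z = ∑ I : n → κ, (∏ i, b.repr (z i) (I i)) * f (fun i => b (I i)) := by
  conv_lhs => rw [show z = fun i => ∑ j, b.repr (z i) j • b j from
    funext fun i => (b.sum_repr (z i)).symm]
  rw [MultilinearMap.map_sum]
  exact Finset.sum_congr rfl fun I _ => by rw [MultilinearMap.map_smul_univ, smul_eq_mul]

theorem continuous_multilinear {n W : Type*} [Fintype n]
    [NormedAddCommGroup W] [NormedSpace ℝ W] [FiniteDimensional ℝ W]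
    (f : MultilinearMap ℝ (fun _ : n => W) ℝ) : Continuous f := by
  classical
  let b := Module.finBasis ℝ W
  rw [show ⇑f = fun z => _ from funext (multilinear_eq_sum_basis b f)]
  refine continuous_finsetSum _ fun I _ => Continuous.mul ?_ continuous_const
  exact continuous_finsetProd _ fun i _ =>
    (LinearMap.continuous_of_finiteDimensional (b.coord (I i))).comp (continuous_apply i)

variable {E : Type*} [NormedAddCommGroup E] [NormedSpace ℝ E] {r s : ℕ}

/-- A tensor as a multilinear map in `r + s` arguments, all of them in `E × E*`. -/
def Tensor.uncurry (T : Tensor r s E) :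
    MultilinearMap ℝ (fun _ : Fin r ⊕ Fin s => E × (E →L[ℝ] ℝ)) ℝ :=
  MultilinearMap.uncurrySum
    ((MultilinearMap.compLinearMapₗ
      (fun _ : Fin s => (ContinuousLinearMap.coeLM ℝ : (E →L[ℝ] ℝ) →ₗ[ℝ] Module.Dual ℝ E) ∘ₗ
        LinearMap.snd ℝ E (E →L[ℝ] ℝ))).compMultilinearMap
      (T.compLinearMap fun _ : Fin r => LinearMap.fst ℝ E (E →L[ℝ] ℝ)))

theorem Tensor.uncurry_apply (T : Tensor r s E) (z : Fin r ⊕ Fin s → E × (E →L[ℝ] ℝ)) :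
    T.uncurry z = T (fun i => (z (Sum.inl i)).1) (fun j => ((z (Sum.inr j)).2 : E →ₗ[ℝ] ℝ)) :=
  rfl

variable [FiniteDimensional ℝ E]

/-- Expanding in a basis of E × E* leaves a finite sum of products of smooth coordinates with
components of T at constant arguments. Uncurrying treats vectors and covectors alike. -/
theorem Tensor.contMDiffWithinAt_apply {N : Type*} {H : Type*} {E' : Type*} [NormedAddCommGroup E']
    [NormedSpace ℝ E'] [TopologicalSpace H] [TopologicalSpace N] [ChartedSpace H N]
    {I : ModelWithCorners ℝ E' H} {S : Set N} {x : N}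
    {T : N → Tensor r s E} {v : N → Fin r → E} {β : N → Fin s → (E →L[ℝ] ℝ)}
    (hT : ∀ v β, ContMDiffWithinAt I 𝓘(ℝ, ℝ) ∞ (fun y => T y v β) S x)
    (hv : ∀ i, ContMDiffWithinAt I 𝓘(ℝ, E) ∞ (fun y => v y i) S x)
    (hβ : ∀ j, ContMDiffWithinAt I 𝓘(ℝ, E →L[ℝ] ℝ) ∞ (fun y => β y j) S x) :
    ContMDiffWithinAt I 𝓘(ℝ, ℝ) ∞ (fun y => T y (v y) (fun j => (β y j : E →ₗ[ℝ] ℝ))) S x := by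
  let b := Module.finBasis ℝ (E × (E →L[ℝ] ℝ))
  let z : N → Fin r ⊕ Fin s → E × (E →L[ℝ] ℝ) := fun y =>
    Sum.elim (fun i => (v y i, 0)) (fun j => (0, β y j))
  have hz : ∀ i, ContMDiffWithinAt I 𝓘(ℝ, E × (E →L[ℝ] ℝ)) ∞ (fun y => z y i) S x := by
    rintro (i | j)
    · exact (hv i).prodMk_space contMDiffWithinAt_const
    · exact contMDiffWithinAt_const.prodMk_space (hβ j)
  have key : (fun y => T y (v y) (fun j => (β y j : E →ₗ[ℝ] ℝ))) = fun y =>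
      ∑ J : Fin r ⊕ Fin s → _, (∏ i, b.repr (z y i) (J i)) *
        (T y).uncurry (fun i => b (J i)) :=
    funext fun y => multilinear_eq_sum_basis b (T y).uncurry (z y)
  rw [key]
  refine contMDiffWithinAt_finsetSum fun J _ => ContMDiffWithinAt.mul ?_ ?_
  · refine contMDiffWithinAt_finsetProd fun i _ => ?_
    exact (LinearMap.toContinuousLinearMap (b.coord (J i))).contDiff.contMDiff.contMDiffAt.comp_contMDiffWithinAt x (hz i)
  · exact hT _ _

/-- This is the Leibniz rule in the r + s slots. `C` stands for the inverse of `B`, whence its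
derivative -A; vector slots contribute A and covector slots -A, the opposite of the signs in θ. -/
theorem Tensor.hasDerivAt_pullback (T : Tensor r s E) {B C : ℝ → E →L[ℝ] E} {A : E →L[ℝ] E}
    {t : ℝ} (hB : HasDerivAt B A t) (hC : HasDerivAt C (-A) t) (hB1 : ∀ w, B t w = w)
    (hC1 : ∀ w, C t w = w) (v : Fin r → E) (β : Fin s → Module.Dual ℝ E) :
    HasDerivAt (fun u => T (fun i => B u (v i)) (fun j => β j ∘ₗ (C u : E →ₗ[ℝ] E)))
      (-Tensor.theta (A : E →ₗ[ℝ] E) T v β) t := by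
  classical
  let f : ContinuousMultilinearMap ℝ (fun _ : Fin r ⊕ Fin s => E × (E →L[ℝ] ℝ)) ℝ :=
    ⟨T.uncurry, continuous_multilinear _⟩
  let β' : Fin s → E →L[ℝ] ℝ := fun j => LinearMap.toContinuousLinearMap (β j)
  let g : Fin r ⊕ Fin s → ℝ → E × (E →L[ℝ] ℝ) :=
    Sum.rec (fun i u => (B u (v i), 0)) (fun j u => (0, (β' j).comp (C u)))
  let g' : Fin r ⊕ Fin s → E × (E →L[ℝ] ℝ) :=
    Sum.rec (fun i => (A (v i), 0)) (fun j => (0, (β' j).comp (-A)))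
  have hg : ∀ i, HasDerivAt (g i) (g' i) t := by
    rintro (i | j)
    · have h1 : HasDerivAt (fun u => B u (v i)) (A (v i)) t := by
        simpa using hB.clm_apply (hasDerivAt_const t (v i))
      exact h1.prodMk (hasDerivAt_const t (0 : E →L[ℝ] ℝ))
    · have h1 : HasDerivAt (fun u => (β' j).comp (C u)) ((β' j).comp (-A)) t := by
        simpa using (hasDerivAt_const t (β' j)).clm_comp hC
      exact (hasDerivAt_const t (0 : E)).prodMk h1
  have h := (HasFDerivAt.multilinear_comp f fun i => (hg i).hasFDerivAt).hasDerivAt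
  refine (h.congr_deriv ?_ : HasDerivAt (fun u => f (fun i => g i u)) _ t)
  have e0 : ∀ (i : Fin r), (g (Sum.inl i) t).1 = v i := fun i => hB1 (v i)
  have e1 : ∀ (j : Fin s), ((g (Sum.inr j) t).2 : E →ₗ[ℝ] ℝ) = β j := fun j => by
    ext w; change β j (C t w) = β j w; rw [hC1]
  have e2 : ∀ i, (f.toContinuousLinearMap (fun k => g k t) i ∘L
      ContinuousLinearMap.toSpanSingleton ℝ (g' i)) 1 =
      T.uncurry (Function.update (fun k => g k t) i (g' i)) := fun i => by
    rw [ContinuousLinearMap.comp_apply, ContinuousLinearMap.toSpanSingleton_apply, one_smul]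
    rfl
  rw [sum_apply, Finset.sum_congr rfl fun i _ => e2 i, Fintype.sum_sum_type, Tensor.theta,
    neg_sub, sub_eq_add_neg, ← Finset.sum_neg_distrib]
  congr 1
  · refine Finset.sum_congr rfl fun i _ => ?_
    rw [Tensor.uncurry_apply]
    congr 1
    · congr 1
      ext k
      by_cases hk : k = i
      · subst hk; simp [g']
      · simp [hk, e0]
    · ext k; simp [e1]
  · refine Finset.sum_congr rfl fun j _ => ?_
    have h1 : (fun i => (Function.update (fun i => g i t) (Sum.inr j) (g' (Sum.inr j))
        (Sum.inl i)).1) = v := by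
      ext i; simp [e0]
    have h2 : (fun i => ((Function.update (fun i => g i t) (Sum.inr j) (g' (Sum.inr j))
        (Sum.inr i)).2 : E →ₗ[ℝ] ℝ)) = Function.update β j (-(β j ∘ₗ (A : E →ₗ[ℝ] E))) := by
      funext k
      by_cases hk : k = j
      · subst hk; ext w; simp [g', β']
      · simp [hk, e1]
    rw [Tensor.uncurry_apply, h1, h2, ← neg_one_smul ℝ, MultilinearMap.map_update_smul,
      neg_one_smul]

end TensorCalculus

/-! ### Images of maps of constant deficient rank. -/

section ConstantRank

variable {F E : Type*} [NormedAddCommGroup F] [NormedSpace ℝ F] [FiniteDimensional ℝ F]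
  [NormedAddCommGroup E] [NormedSpace ℝ E]

/-- A map of locally constant rank less than the dimension of the target has a small image. -/
theorem exists_nhds_dimH_image_lt {f : F → E} {x₀ : F} (hf : ContDiffAt ℝ 1 f x₀)
    (hrank : ∀ᶠ x in 𝓝 x₀, Module.finrank ℝ (fderiv ℝ f x).range =
      Module.finrank ℝ (fderiv ℝ f x₀).range)
    (hlt : Module.finrank ℝ (fderiv ℝ f x₀).range < Module.finrank ℝ E) :
    ∃ U ∈ 𝓝 x₀, dimH (f '' U) < Module.finrank ℝ E := by
  set L := fderiv ℝ f x₀ with hL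
  obtain ⟨Q, hQ⟩ : ∃ Q : E →L[ℝ] L.range, ∀ y : L.range, Q y = y :=
    Submodule.ClosedComplemented.of_finiteDimensional L.range
  obtain ⟨p, hp⟩ : ∃ p : F →L[ℝ] L.ker, ∀ y : L.ker, p y = y :=
    Submodule.ClosedComplemented.of_finiteDimensional L.ker
  -- Straightening coordinates as in the constant rank theorem: the differential of `g` at x₀ is an
  -- isomorphism, and in these coordinates f turns out to depend on the first factor only.
  let g : F → L.range × L.ker := fun x => (Q (f x), p x)
  have hLf : HasFDerivAt f L x₀ := (hf.differentiableAt (by simp)).hasFDerivAt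
  have hg : ContDiffAt ℝ 1 g x₀ :=
    (Q.contDiff.contDiffAt.comp x₀ hf).prodMk p.contDiff.contDiffAt
  have hg' : HasFDerivAt g ((Q ∘L L).prod p) x₀ := (Q.hasFDerivAt.comp x₀ hLf).prodMk p.hasFDerivAt
  have hinj : Function.Injective ((Q ∘L L).prod p) := by
    rw [injective_iff_map_eq_zero]
    intro v hv
    have h1 : Q (L v) = 0 := congrArg Prod.fst hv
    have h2 : p v = 0 := congrArg Prod.snd hv
    have h3 : L v = 0 := by
      have := hQ ⟨L v, LinearMap.mem_range_self _ v⟩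
      simp only [h1] at this
      exact (congrArg Subtype.val this).symm
    have := hp ⟨v, h3⟩
    simp only [h2] at this
    exact (congrArg Subtype.val this).symm
  have hdim : Module.finrank ℝ F = Module.finrank ℝ (L.range × L.ker) := by
    rw [Module.finrank_prod]
    exact (LinearMap.finrank_range_add_finrank_ker (L : F →ₗ[ℝ] E)).symm
  let e : F ≃L[ℝ] L.range × L.ker :=
    (LinearEquiv.ofInjectiveOfFinrankEq (((Q ∘L L).prod p) : F →ₗ[ℝ] L.range × L.ker) hinj
      hdim).toContinuousLinearEquiv
  have hge : HasFDerivAt g (e : F →L[ℝ] L.range × L.ker) x₀ := by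
    convert hg' using 1
    exact ContinuousLinearMap.ext fun v => rfl
  let Ψ := hg.toOpenPartialHomeomorph g hge (by simp)
  have hΨ : ∀ x, Ψ x = g x := fun x => rfl
  have hx₀ : x₀ ∈ Ψ.source := hg.mem_toOpenPartialHomeomorph_source hge (by simp)
  have hG : ContDiffAt ℝ 1 Ψ.symm (g x₀) := hg.to_localInverse hge (by simp)
  have hG0 : Ψ.symm (g x₀) = x₀ := Ψ.left_inv hx₀
  have htend : Tendsto Ψ.symm (𝓝 (g x₀)) (𝓝 x₀) := by
    have := hG.continuousAt.tendsto; rwa [hG0] at this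
  let h : L.range × L.ker → E := fun y => f (Ψ.symm y)
  have hev : ∀ᶠ y in 𝓝 (g x₀), ContDiffAt ℝ 1 h y ∧
      ∀ w : L.ker, fderiv ℝ h y (0, w) = 0 := by
    have hT : ∀ᶠ y in 𝓝 (g x₀), y ∈ Ψ.target :=
      Ψ.open_target.mem_nhds (Ψ.map_source hx₀)
    filter_upwards [hG.eventually (by simp), htend.eventually (hf.eventually (by simp)),
      htend.eventually hrank, hT.eventually_nhds] with y h1 h2 h3 h4
    refine ⟨h2.comp y h1, fun w => ?_⟩
    have d1 := (h1.differentiableAt (by simp)).hasFDerivAt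
    have d2 := (h2.differentiableAt (by simp)).hasFDerivAt
    have d3 : HasFDerivAt h _ y := d2.comp y d1
    have d4 : ∀ u : L.range × L.ker, Q (fderiv ℝ h y u) = u.1 := by
      have a1 : HasFDerivAt (fun y => Q (h y)) (Q ∘L fderiv ℝ h y) y :=
        Q.hasFDerivAt.comp y d3.differentiableAt.hasFDerivAt
      have a2 : HasFDerivAt (fun y => Q (h y)) (ContinuousLinearMap.fst ℝ L.range L.ker) y := by
        refine hasFDerivAt_fst.congr_of_eventuallyEq ?_
        filter_upwards [h4] with z hz
        exact congrArg Prod.fst (Ψ.right_inv hz)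
      intro u
      exact congrArg (fun A => A u) (a1.unique a2)
    set D := fderiv ℝ f (Ψ.symm y) with hD
    have d5 : ∀ u, fderiv ℝ h y u ∈ D.range := fun u => by
      rw [d3.fderiv]; exact LinearMap.mem_range_self (D : F →ₗ[ℝ] E) _
    -- `Q` maps the range of `D` onto that of `L`; equality of ranks makes it injective there. It
    -- kills the derivative of `h` along the kernel directions, so that derivative vanishes.
    let q : D.range →ₗ[ℝ] L.range := (Q : E →ₗ[ℝ] L.range) ∘ₗ D.range.subtype
    have hq : Function.Surjective q := fun u => ⟨⟨fderiv ℝ h y (u, 0), d5 _⟩, d4 (u, 0)⟩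
    have hqi : Function.Injective q :=
      (LinearMap.injective_iff_surjective_of_finrank_eq_finrank h3).2 hq
    have : (⟨fderiv ℝ h y (0, w), d5 _⟩ : D.range) = 0 := hqi (by
      rw [map_zero]; exact d4 (0, w))
    exact congrArg Subtype.val this
  obtain ⟨ε, hε, hball⟩ := Metric.eventually_nhds_iff_ball.1 hev
  have hprod : ∀ u ∈ Metric.ball (g x₀).1 ε, ∀ w ∈ Metric.ball (g x₀).2 ε,
      (u, w) ∈ Metric.ball (g x₀) ε := fun u hu w hw => by
    rw [← ball_prod_same]; exact ⟨hu, hw⟩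
  have hconst : ∀ u ∈ Metric.ball (g x₀).1 ε, ∀ w ∈ Metric.ball (g x₀).2 ε,
      h (u, w) = h (u, (g x₀).2) := by
    intro u hu w hw
    have hd : ∀ w ∈ Metric.ball (g x₀).2 ε, HasFDerivAt (fun w => h (u, w))
        (0 : L.ker →L[ℝ] E) w := by
      intro w hw
      obtain ⟨c1, c2⟩ := hball _ (hprod u hu w hw)
      have := (c1.differentiableAt (by simp)).hasFDerivAt.comp w
        ((hasFDerivAt_const u w).prodMk (hasFDerivAt_id w))
      exact this.congr_fderiv (ContinuousLinearMap.ext fun w' => c2 w')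
    exact Metric.isOpen_ball.is_const_of_fderiv_eq_zero
      (convex_ball _ _).isPreconnected
      (fun w hw => (hd w hw).differentiableAt.differentiableWithinAt)
      (fun w hw => (hd w hw).fderiv) hw (Metric.mem_ball_self hε)
  refine ⟨Ψ.source ∩ g ⁻¹' Metric.ball (g x₀) ε, inter_mem (Ψ.open_source.mem_nhds hx₀)
    (hg.continuousAt.preimage_mem_nhds (Metric.ball_mem_nhds _ hε)), ?_⟩
  -- The image lies in a C¹ image of a ball of `L.range`, so its Hausdorff dimension is at most the
  -- rank.
  have hsub : f '' (Ψ.source ∩ g ⁻¹' Metric.ball (g x₀) ε) ⊆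
      (fun u => h (u, (g x₀).2)) '' Metric.ball (g x₀).1 ε := by
    rintro _ ⟨x, ⟨hx, hxb⟩, rfl⟩
    have hxb' : g x ∈ Metric.ball (g x₀).1 ε ×ˢ Metric.ball (g x₀).2 ε := by
      rw [ball_prod_same]; exact hxb
    refine ⟨(g x).1, hxb'.1, ?_⟩
    change h ((g x).1, (g x₀).2) = f x
    rw [← hconst _ hxb'.1 _ hxb'.2]
    exact congrArg f (Ψ.left_inv hx)
  have hC : ContDiffOn ℝ 1 (fun u => h (u, (g x₀).2)) (Metric.ball (g x₀).1 ε) := fun u hu =>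
    ((hball _ (hprod u hu _ (Metric.mem_ball_self hε))).1.comp u
      (contDiffAt_id.prodMk contDiffAt_const)).contDiffWithinAt
  calc dimH (f '' _) ≤ dimH _ := dimH_mono hsub
    _ ≤ dimH (Metric.ball (g x₀).1 ε) := hC.dimH_image_le (convex_ball _ _) Subset.rfl
    _ ≤ dimH (univ : Set L.range) := dimH_mono (subset_univ _)
    _ = Module.finrank ℝ L.range := Real.dimH_univ_eq_finrank _
    _ < Module.finrank ℝ E := by exact_mod_cast hlt

end ConstantRank

/-! ### Pull-back in local trivializations and its smooth dependence on parameters. -/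

section SmoothFamilies

variable {E : Type*} [NormedAddCommGroup E] [NormedSpace ℝ E]
  {M : Type*} [TopologicalSpace M] [ChartedSpace E M] [IsManifold 𝓘(ℝ, E) ∞ M]
  {ι : Type*} {r s : ι → ℕ}

/-- The tensor on the model space that represents `γ` at `p` in the trivialization at `x₀`. -/
def TensorField.localTensor (γ : TensorField E M r s) (x₀ : M) (k : ι) (p : M) :
    Tensor (r k) (s k) E :=
  (MultilinearMap.compLinearMapₗ (fun _ : Fin (s k) => Module.Dual.transpose (R := ℝ)
    ((trivializationAt E (TangentSpace 𝓘(ℝ, E)) x₀).continuousLinearMapAt ℝ p).toLinearMap)).compMultilinearMap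
      ((γ p k).compLinearMap fun _ =>
        ((trivializationAt E (TangentSpace 𝓘(ℝ, E)) x₀).symmL ℝ p).toLinearMap)

theorem TensorField.localTensor_apply (γ : TensorField E M r s) (x₀ : M) (k : ι) (p : M)
    (v : Fin (r k) → E) (β : Fin (s k) → Module.Dual ℝ E) :
    γ.localTensor x₀ k p v β = γ.component x₀ k v β p := rfl

/-- The differential of a diffeomorphism at `p`, in the trivializations at `x₀` and `y₀`. -/
def Diff.localDeriv (f : Diff E M) (x₀ y₀ p : M) : E →L[ℝ] E :=
  ContinuousLinearMap.inCoordinates E (TangentSpace 𝓘(ℝ, E)) E (TangentSpace 𝓘(ℝ, E)) x₀ p y₀ (f p)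
    (mfderiv 𝓘(ℝ, E) 𝓘(ℝ, E) f p)

theorem Diff.localDeriv_apply (f : Diff E M) (x₀ y₀ p : M) (v : E) :
    f.localDeriv x₀ y₀ p v =
      (trivializationAt E (TangentSpace 𝓘(ℝ, E)) y₀).continuousLinearMapAt ℝ (f p)
        (f.tangentEquiv p ((trivializationAt E (TangentSpace 𝓘(ℝ, E)) x₀).symmL ℝ p v)) := rfl

/-- The differential of a diffeomorphism in trivializations, as an equivalence. -/
def Diff.localEquiv (f : Diff E M) {x₀ y₀ p : M}
    (hp : p ∈ (trivializationAt E (TangentSpace 𝓘(ℝ, E)) x₀).baseSet)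
    (hy : f p ∈ (trivializationAt E (TangentSpace 𝓘(ℝ, E)) y₀).baseSet) : E ≃L[ℝ] E :=
  (((trivializationAt E (TangentSpace 𝓘(ℝ, E)) x₀).continuousLinearEquivAt ℝ p hp).symm.trans
    (f.mfderivToContinuousLinearEquiv (by simp) p)).trans
    ((trivializationAt E (TangentSpace 𝓘(ℝ, E)) y₀).continuousLinearEquivAt ℝ (f p) hy)

theorem Diff.coe_localEquiv (f : Diff E M) {x₀ y₀ p : M}
    (hp : p ∈ (trivializationAt E (TangentSpace 𝓘(ℝ, E)) x₀).baseSet)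
    (hy : f p ∈ (trivializationAt E (TangentSpace 𝓘(ℝ, E)) y₀).baseSet) :
    (f.localEquiv hp hy : E →L[ℝ] E) = f.localDeriv x₀ y₀ p := by
  rw [Diff.localDeriv, ContinuousLinearMap.inCoordinates_eq hp hy]
  rfl

theorem Diff.localEquiv_symm_apply (f : Diff E M) {x₀ y₀ p : M}
    (hp : p ∈ (trivializationAt E (TangentSpace 𝓘(ℝ, E)) x₀).baseSet)
    (hy : f p ∈ (trivializationAt E (TangentSpace 𝓘(ℝ, E)) y₀).baseSet) (w : E) :
    (f.localEquiv hp hy).symm w =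
      (trivializationAt E (TangentSpace 𝓘(ℝ, E)) x₀).continuousLinearMapAt ℝ p
        ((f.tangentEquiv p).symm
          ((trivializationAt E (TangentSpace 𝓘(ℝ, E)) y₀).symmL ℝ (f p) w)) := by
  simp only [← Trivialization.coe_continuousLinearEquivAt_eq _ hp,
    ← Trivialization.symm_continuousLinearEquivAt_eq _ hy]
  rfl

theorem TensorField.component_pullback (γ : TensorField E M r s) (f : Diff E M) {x₀ y₀ p : M}
    (hp : p ∈ (trivializationAt E (TangentSpace 𝓘(ℝ, E)) x₀).baseSet)
    (hy : f p ∈ (trivializationAt E (TangentSpace 𝓘(ℝ, E)) y₀).baseSet)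
    (k : ι) (v : Fin (r k) → E) (β : Fin (s k) → Module.Dual ℝ E) :
    (γ.pullback f).component x₀ k v β p =
      γ.localTensor y₀ k (f p) (fun i => f.localDeriv x₀ y₀ p (v i))
        (fun j => β j ∘ₗ ((f.localEquiv hp hy).symm : E →ₗ[ℝ] E)) := by
  rw [TensorField.localTensor_apply, TensorField.component, TensorField.component,
    TensorField.pullback, Tensor.pullback_apply]
  have h1 : ∀ w : E, (trivializationAt E (TangentSpace 𝓘(ℝ, E)) y₀).symmL ℝ (f p)
      (f.localDeriv x₀ y₀ p w) = f.tangentEquiv p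
        ((trivializationAt E (TangentSpace 𝓘(ℝ, E)) x₀).symmL ℝ p w) := fun w => by
    rw [Diff.localDeriv_apply, Trivialization.symmL_continuousLinearMapAt _ hy]
  have h2 : ∀ j, (β j ∘ₗ ((f.localEquiv hp hy).symm : E →ₗ[ℝ] E)) ∘ₗ
      ((trivializationAt E (TangentSpace 𝓘(ℝ, E)) y₀).continuousLinearMapAt ℝ (f p)).toLinearMap =
      (β j ∘ₗ ((trivializationAt E (TangentSpace 𝓘(ℝ, E)) x₀).continuousLinearMapAt ℝ p).toLinearMap)
        ∘ₗ ((f.tangentEquiv p).symm : _ →ₗ[ℝ] _) := fun j => by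
    ext w
    change β j ((f.localEquiv hp hy).symm _) = β j _
    rw [Diff.localEquiv_symm_apply]
    exact congrArg (fun u => β j ((trivializationAt E (TangentSpace 𝓘(ℝ, E)) x₀).continuousLinearMapAt
      ℝ p ((f.tangentEquiv p).symm u)))
        (Trivialization.symmL_continuousLinearMapAt (R := ℝ) _ hy w)
  simp only [h1, h2]

/-- The parametrized differential is smooth in the trivialization centred at p₀; a smooth change of
trivialization passes to x₀. -/
theorem Diff.contMDiffAt_localDeriv {f : ℝ → Diff E M} {t₀ : ℝ} {p₀ x₀ : M}
    (hf : ContMDiffAt (𝓘(ℝ, ℝ).prod 𝓘(ℝ, E)) 𝓘(ℝ, E) ∞ (fun z : ℝ × M => f z.1 z.2) (t₀, p₀))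
    (hp₀ : p₀ ∈ (trivializationAt E (TangentSpace 𝓘(ℝ, E)) x₀).baseSet) :
    ContMDiffAt (𝓘(ℝ, ℝ).prod 𝓘(ℝ, E)) 𝓘(ℝ, E →L[ℝ] E) ∞
      (fun z : ℝ × M => (f z.1).localDeriv x₀ (f t₀ p₀) z.2) (t₀, p₀) := by
  have h1 : ContMDiffAt (𝓘(ℝ, ℝ).prod 𝓘(ℝ, E)) 𝓘(ℝ, E →L[ℝ] E) ∞
      (fun z : ℝ × M => (f z.1).localDeriv p₀ (f t₀ p₀) z.2) (t₀, p₀) := by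
    refine ContMDiffAt.mfderiv (n := ∞) (x₀ := ((t₀, p₀) : ℝ × M))
      (fun (z : ℝ × M) (p : M) => f z.1 p) (fun z => z.2) ?_ contMDiffAt_snd (by simp)
    exact ContMDiffAt.comp (I' := 𝓘(ℝ, ℝ).prod 𝓘(ℝ, E)) (f := fun w : (ℝ × M) × M => (w.1.1, w.2))
      (((t₀, p₀), p₀) : (ℝ × M) × M) hf
      ((contMDiffAt_fst.comp _ contMDiffAt_fst).prodMk contMDiffAt_snd)
  have hp₀' := FiberBundle.mem_baseSet_trivializationAt' (F := E)
    (E := (TangentSpace 𝓘(ℝ, E) : M → Type _)) p₀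
  have h2 := ((contMDiffOn_coordChangeL (IB := 𝓘(ℝ, E)) (n := ∞) (F := E)
    (E := (TangentSpace 𝓘(ℝ, E) : M → Type _))
    (trivializationAt E (TangentSpace 𝓘(ℝ, E)) x₀)
    (trivializationAt E (TangentSpace 𝓘(ℝ, E)) p₀)).contMDiffAt
      (((trivializationAt E (TangentSpace 𝓘(ℝ, E)) x₀).open_baseSet.inter
        (trivializationAt E (TangentSpace 𝓘(ℝ, E)) p₀).open_baseSet).mem_nhds ⟨hp₀, hp₀'⟩)).comp
      ((t₀, p₀) : ℝ × M) (contMDiffAt_snd (I := 𝓘(ℝ, ℝ)) (J := 𝓘(ℝ, E)))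
  refine (h1.clm_comp h2).congr_of_eventuallyEq ?_
  have h3 : ∀ᶠ z : ℝ × M in 𝓝 (t₀, p₀),
      z.2 ∈ (trivializationAt E (TangentSpace 𝓘(ℝ, E)) x₀).baseSet ∩
        (trivializationAt E (TangentSpace 𝓘(ℝ, E)) p₀).baseSet :=
    continuousAt_snd.preimage_mem_nhds
      (((trivializationAt E (TangentSpace 𝓘(ℝ, E)) x₀).open_baseSet.inter
        (trivializationAt E (TangentSpace 𝓘(ℝ, E)) p₀).open_baseSet).mem_nhds ⟨hp₀, hp₀'⟩)
  filter_upwards [h3] with z hz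
  ext w
  change (f z.1).localDeriv x₀ (f t₀ p₀) z.2 w = (f z.1).localDeriv p₀ (f t₀ p₀) z.2 _
  rw [Diff.localDeriv_apply, Diff.localDeriv_apply]
  congr 2
  change _ = (trivializationAt E (TangentSpace 𝓘(ℝ, E)) p₀).symmL ℝ z.2
    (Trivialization.coordChangeL ℝ (trivializationAt E (TangentSpace 𝓘(ℝ, E)) x₀) (trivializationAt E (TangentSpace 𝓘(ℝ, E)) p₀) z.2 w)
  rw [Trivialization.coordChangeL_apply _ _ hz]
  have e1 := Trivialization.symmL_continuousLinearMapAt (R := ℝ)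
    (trivializationAt E (TangentSpace 𝓘(ℝ, E)) p₀) hz.2
    ((trivializationAt E (TangentSpace 𝓘(ℝ, E)) x₀).symmL ℝ z.2 w)
  rw [Trivialization.continuousLinearMapAt_apply_of_mem ℝ _ hz.2] at e1
  rw [← Trivialization.symmL_apply (R := ℝ) _ hz.1]
  exact e1.symm

variable [FiniteDimensional ℝ E]

/-- Covectors are moved by the inverse of the differential, and inversion of operators is smooth, so
smoothness of the inverse diffeomorphisms in t is not needed. -/
theorem TensorField.IsSmoothFamily.pullback {J : Set ℝ} (hJ : IsOpen J)
    {γ : ℝ → TensorField E M r s} (hγ : TensorField.IsSmoothFamily J γ) {f : ℝ → Diff E M}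
    (hf : ∀ t ∈ J, ∀ p, ContMDiffAt (𝓘(ℝ, ℝ).prod 𝓘(ℝ, E)) 𝓘(ℝ, E) ∞
      (fun z : ℝ × M => f z.1 z.2) (t, p)) :
    TensorField.IsSmoothFamily J (fun t => (γ t).pullback (f t)) := by
  rintro x₀ k v β ⟨t₀, p₀⟩ ⟨ht₀, hp₀⟩
  refine ContMDiffAt.contMDiffWithinAt ?_
  have hft := hf t₀ ht₀ p₀
  set y₀ := f t₀ p₀ with hy₀
  have hyb := FiberBundle.mem_baseSet_trivializationAt' (F := E)
    (E := (TangentSpace 𝓘(ℝ, E) : M → Type _)) y₀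
  have hB := Diff.contMDiffAt_localDeriv hft hp₀
  have hev1 : ∀ᶠ z : ℝ × M in 𝓝 (t₀, p₀),
      z.2 ∈ (trivializationAt E (TangentSpace 𝓘(ℝ, E)) x₀).baseSet :=
    continuousAt_snd.preimage_mem_nhds
      ((trivializationAt E (TangentSpace 𝓘(ℝ, E)) x₀).open_baseSet.mem_nhds hp₀)
  have hev2 : ∀ᶠ z : ℝ × M in 𝓝 (t₀, p₀),
      f z.1 z.2 ∈ (trivializationAt E (TangentSpace 𝓘(ℝ, E)) y₀).baseSet :=
    hft.continuousAt.preimage_mem_nhds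
      ((trivializationAt E (TangentSpace 𝓘(ℝ, E)) y₀).open_baseSet.mem_nhds hyb)
  have hinv : ContMDiffAt (𝓘(ℝ, ℝ).prod 𝓘(ℝ, E)) 𝓘(ℝ, E →L[ℝ] E) ∞
      (fun z : ℝ × M => ((f z.1).localDeriv x₀ y₀ z.2).inverse) (t₀, p₀) := by
    have := contDiffAt_map_inverse (n := ∞) ((f t₀).localEquiv hp₀ hyb)
    rw [Diff.coe_localEquiv] at this
    exact this.contMDiffAt.comp (t₀, p₀) hB
  let β' : Fin (s k) → E →L[ℝ] ℝ := fun j => LinearMap.toContinuousLinearMap (β j)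
  have main : ContMDiffAt (𝓘(ℝ, ℝ).prod 𝓘(ℝ, E)) 𝓘(ℝ, ℝ) ∞
      (fun z : ℝ × M => (γ z.1).localTensor y₀ k (f z.1 z.2)
        (fun i => (f z.1).localDeriv x₀ y₀ z.2 (v i))
        (fun j => (((β' j).comp ((f z.1).localDeriv x₀ y₀ z.2).inverse : E →L[ℝ] ℝ) :
          E →ₗ[ℝ] ℝ))) (t₀, p₀) := by
    rw [← contMDiffWithinAt_univ]
    refine Tensor.contMDiffWithinAt_apply (fun v β => ?_) (fun i => ?_) (fun j => ?_)
    · rw [contMDiffWithinAt_univ]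
      have h1 := (hγ y₀ k v β).contMDiffAt (x := (t₀, y₀)) (prod_mem_nhds (hJ.mem_nhds ht₀)
        ((trivializationAt E (TangentSpace 𝓘(ℝ, E)) y₀).open_baseSet.mem_nhds hyb))
      exact ContMDiffAt.comp (I' := 𝓘(ℝ, ℝ).prod 𝓘(ℝ, E)) (f := fun z : ℝ × M => (z.1, f z.1 z.2)) (t₀, p₀) h1
        (contMDiffAt_fst.prodMk hft)
    · rw [contMDiffWithinAt_univ]
      exact hB.clm_apply contMDiffAt_const
    · rw [contMDiffWithinAt_univ]
      exact contMDiffAt_const.clm_comp hinv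
  refine main.congr_of_eventuallyEq ?_
  filter_upwards [hev1, hev2] with z hz1 hz2
  rw [TensorField.component_pullback _ _ hz1 hz2]
  congr 1
  funext j
  rw [← Diff.coe_localEquiv _ hz1 hz2, ContinuousLinearMap.inverse_equiv]
  rfl

end SmoothFamilies

/-! ### Self-similar solutions and normalization of the automorphism group. -/

section Solutions

variable {E : Type*} [NormedAddCommGroup E] [NormedSpace ℝ E]
  {M : Type*} [TopologicalSpace M] [ChartedSpace E M]
  {ι : Type*} {r s : ι → ℕ}

theorem TensorField.pullback_smul (γ : TensorField E M r s) (f : Diff E M) (c : ℝ) :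
    (c • γ).pullback f = c • γ.pullback f := rfl

theorem mem_autGroup {γ : TensorField E M r s} {f : Diff E M} :
    f ∈ autGroup γ ↔ γ.pullback f = γ := Iff.rfl

theorem IsHomogeneous.smul {γ : TensorField E M r s} (h : IsHomogeneous γ) (c : ℝ) :
    IsHomogeneous (c • γ) := fun p p' => by
  obtain ⟨f, hf, hp⟩ := h p p'
  refine ⟨f, ?_, hp⟩
  rw [mem_autGroup] at hf ⊢
  rw [TensorField.pullback_smul, hf]

theorem conj_mem_autGroup_pullback {γ : TensorField E M r s} {f a : Diff E M} :
    a ∈ autGroup (γ.pullback f) ↔ f * a * f⁻¹ ∈ autGroup γ := by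
  simp only [mem_autGroup, TensorField.pullback_mul]
  constructor
  · intro h
    rw [h, ← TensorField.pullback_mul, mul_inv_cancel, TensorField.pullback_one]
  · intro h
    conv_rhs => rw [← h]
    rw [← TensorField.pullback_mul f⁻¹ f, inv_mul_cancel, TensorField.pullback_one]

theorem IsHomogeneous.pullback {γ : TensorField E M r s} (h : IsHomogeneous γ) (f : Diff E M) :
    IsHomogeneous (γ.pullback f) := fun p p' => by
  obtain ⟨a, ha, hp⟩ := h (f p) (f p')
  refine ⟨f⁻¹ * a * f, ?_, ?_⟩
  · rw [conj_mem_autGroup_pullback]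
    simpa [mul_assoc] using ha
  · change f.symm (a (f p)) = p'
    rw [hp]
    exact f.symm_apply_apply p'

/-- The group law gives φ_t^* γ = φ_u^* (φ_{t-u}^* γ), which moves the derivative from 0 to u. -/
theorem HasLieDerivative.hasDerivAt_pullback {φ : ℝ → Diff E M} {γ L : TensorField E M r s}
    (hφ : ∀ t u, φ (t + u) = φ t * φ u) (h : HasLieDerivative φ γ L) (u : ℝ) (p : M) (k : ι)
    (v : Fin (r k) → TangentSpace 𝓘(ℝ, E) p)
    (β : Fin (s k) → Module.Dual ℝ (TangentSpace 𝓘(ℝ, E) p)) :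
    HasDerivAt (fun t => γ.pullback (φ t) p k v β) (L.pullback (φ u) p k v β) u := by
  have h1 := h (φ u p) k (fun i => (φ u).tangentEquiv p (v i))
    (fun j => β j ∘ₗ (((φ u).tangentEquiv p).symm : _ →ₗ[ℝ] _))
  rw [← sub_self u] at h1
  have h2 := h1.comp_sub_const u u
  refine h2.congr_of_eventuallyEq (Eventually.of_forall fun t => ?_)
  have : φ t = φ (t - u) * φ u := by rw [← hφ, sub_add_cancel]
  change γ.pullback (φ t) p k v β = ((γ.pullback (φ (t - u))).pullback (φ u)) p k v β
  rw [this, TensorField.pullback_mul]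

variable [IsManifold 𝓘(ℝ, E) ∞ M]

theorem TensorField.IsSmooth.isSmoothFamily_const {γ : TensorField E M r s} (h : γ.IsSmooth)
    (J : Set ℝ) : TensorField.IsSmoothFamily J (fun _ => γ) := fun x₀ k v β =>
  (h x₀ k v β).comp (contMDiffOn_snd (I := 𝓘(ℝ, ℝ)) (J := 𝓘(ℝ, E))) fun _ hz => hz.2

theorem TensorField.IsSmoothFamily.smul {J : Set ℝ} {γ : ℝ → TensorField E M r s}
    (h : TensorField.IsSmoothFamily J γ) {c : ℝ → ℝ} (hc : ContDiffOn ℝ ∞ c J) :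
    TensorField.IsSmoothFamily J (fun t => c t • γ t) := fun x₀ k v β =>
  (hc.contMDiffOn.comp (contMDiffOn_fst (I := 𝓘(ℝ, ℝ)) (J := 𝓘(ℝ, E))) fun _ hz => hz.1).mul
    (h x₀ k v β)

namespace GeometricFlow

variable (Φ : GeometricFlow E M r s)

theorem IsSolution.pullback [FiniteDimensional ℝ E] {Φ : GeometricFlow E M r s} {J : Set ℝ}
    {γt : ℝ → TensorField E M r s} {γ : TensorField E M r s} (h : Φ.IsSolution J γt γ)
    (f : Diff E M) : Φ.IsSolution J (fun t => (γt t).pullback f) (γ.pullback f) where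
  isOpen := h.isOpen
  ordConnected := h.ordConnected
  zero_mem := h.zero_mem
  initial := congrArg (TensorField.pullback f) h.initial
  mem t ht := Φ.pullback_mem _ (h.mem t ht) f
  smooth := h.smooth.pullback h.isOpen fun t _ p =>
    f.contMDiff.contMDiffAt.comp (t, p) contMDiffAt_snd
  hasDeriv t ht p k v β := by
    rw [Φ.equivariant _ (h.mem t ht)]
    exact h.hasDeriv t ht (f p) k _ _

/-- The reparametrization of time under which the flow of the soliton field produces the
self-similar solution. -/
def time (c t : ℝ) : ℝ :=
  if c = 0 then t else Real.log ((1 - Φ.α) * c * t + 1) / ((1 - Φ.α) * c)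

theorem one_sub_α_pos : 0 < 1 - Φ.α := sub_pos.2 Φ.α_lt_one

theorem isOpen_scaleInterval (c : ℝ) : IsOpen (Φ.scaleInterval c) :=
  isOpen_lt continuous_const (by fun_prop)

theorem ordConnected_scaleInterval (c : ℝ) : (Φ.scaleInterval c).OrdConnected := by
  refine ⟨fun x hx y hy z hz => ?_⟩
  simp only [scaleInterval, mem_ofPred_eq] at *
  rcases le_total 0 ((1 - Φ.α) * c) with h | h <;> nlinarith [hz.1, hz.2]

theorem zero_mem_scaleInterval (c : ℝ) : (0 : ℝ) ∈ Φ.scaleInterval c := by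
  simp [scaleInterval]

theorem scale_zero (c : ℝ) : Φ.scale c 0 = 1 := by simp [scale]

theorem time_zero (c : ℝ) : Φ.time c 0 = 0 := by simp [time]

variable {Φ}

theorem scale_pos {c t : ℝ} (ht : t ∈ Φ.scaleInterval c) : 0 < Φ.scale c t :=
  Real.rpow_pos_of_pos ht _

theorem contDiffAt_scale {c t : ℝ} (ht : t ∈ Φ.scaleInterval c) :
    ContDiffAt ℝ ∞ (Φ.scale c) t :=
  ContDiffAt.rpow_const_of_ne (f := fun t => (1 - Φ.α) * c * t + 1) (by fun_prop)
    (show (0 : ℝ) < (1 - Φ.α) * c * t + 1 from ht).ne'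

theorem contDiffAt_time {c t : ℝ} (ht : t ∈ Φ.scaleInterval c) :
    ContDiffAt ℝ ∞ (Φ.time c) t := by
  by_cases hc : c = 0
  · rw [show Φ.time c = id from funext fun t => by simp [time, hc]]
    exact contDiffAt_id
  · rw [show Φ.time c = fun t => Real.log ((1 - Φ.α) * c * t + 1) / ((1 - Φ.α) * c) from
      funext fun t => by simp [time, hc]]
    refine ContDiffAt.div_const (ContDiffAt.log (by fun_prop) ?_) _
    exact (show (0 : ℝ) < (1 - Φ.α) * c * t + 1 from ht).ne'

/-- With q(γ) = cγ + L, the ansatz c(t) φ_{s(t)}^* γ solves the flow once c' = c · c(t)^α and s' =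
c(t)^(α-1). This is the first equation; `hasDerivAt_time` is the second. -/
theorem hasDerivAt_scale {c t : ℝ} (ht : t ∈ Φ.scaleInterval c) :
    HasDerivAt (Φ.scale c) (Φ.scale c t ^ Φ.α * c) t := by
  have ht' : (0 : ℝ) < (1 - Φ.α) * c * t + 1 := ht
  have ha := Φ.one_sub_α_pos
  have h1 : HasDerivAt (fun t : ℝ => (1 - Φ.α) * c * t + 1) ((1 - Φ.α) * c) t := by
    simpa using ((hasDerivAt_id t).const_mul ((1 - Φ.α) * c)).add_const 1
  refine (h1.rpow_const (p := 1 / (1 - Φ.α)) (Or.inl ht'.ne')).congr_deriv ?_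
  rw [scale, ← Real.rpow_mul ht'.le,
    show 1 / (1 - Φ.α) * Φ.α = 1 / (1 - Φ.α) - 1 by field_simp; ring]
  field_simp

theorem hasDerivAt_time {c t : ℝ} (ht : t ∈ Φ.scaleInterval c) :
    HasDerivAt (Φ.time c) (Φ.scale c t ^ (Φ.α - 1)) t := by
  have ht' : (0 : ℝ) < (1 - Φ.α) * c * t + 1 := ht
  have ha := Φ.one_sub_α_pos
  have h2 : Φ.scale c t ^ (Φ.α - 1) = ((1 - Φ.α) * c * t + 1)⁻¹ := by
    rw [scale, ← Real.rpow_mul ht'.le,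
      show 1 / (1 - Φ.α) * (Φ.α - 1) = -1 by field_simp; ring, Real.rpow_neg_one]
  rw [h2]
  by_cases hc : c = 0
  · rw [show Φ.time c = id from funext fun t => by simp [time, hc]]
    simpa [hc] using hasDerivAt_id t
  · rw [show Φ.time c = fun t => Real.log ((1 - Φ.α) * c * t + 1) / ((1 - Φ.α) * c) from
      funext fun t => by simp [time, hc]]
    have h1 : HasDerivAt (fun t : ℝ => (1 - Φ.α) * c * t + 1) ((1 - Φ.α) * c) t := by
      simpa using ((hasDerivAt_id t).const_mul ((1 - Φ.α) * c)).add_const 1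
    refine ((h1.log ht'.ne').div_const _).congr_deriv ?_
    field_simp

/-- The reparametrized time reaches all of ℝ, so a property proved along the self-similar solution
holds for every φ_u. -/
theorem exists_time_eq (c u : ℝ) : ∃ t ∈ Φ.scaleInterval c, Φ.time c t = u := by
  by_cases hc : c = 0
  · exact ⟨u, by simp [scaleInterval, hc], by simp [time, hc]⟩
  · have ha := Φ.one_sub_α_pos
    have h : (1 - Φ.α) * c * ((Real.exp ((1 - Φ.α) * c * u) - 1) / ((1 - Φ.α) * c)) + 1 =
        Real.exp ((1 - Φ.α) * c * u) := by
      field_simp; ring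
    refine ⟨(Real.exp ((1 - Φ.α) * c * u) - 1) / ((1 - Φ.α) * c), ?_, ?_⟩
    · rw [scaleInterval, mem_ofPred_eq, h]; exact Real.exp_pos _
    · rw [time, if_neg hc, h, Real.log_exp]; field_simp

variable [FiniteDimensional ℝ E]

/-- A soliton gives rise to a self-similar solution. -/
theorem isSolution_of_soliton {γ L : TensorField E M r s} (hγ : γ ∈ Φ.Γ) {c : ℝ}
    {X : ∀ p : M, TangentSpace 𝓘(ℝ, E) p} {φ : ℝ → Diff E M} (hφ : IsCompleteFlow X φ)
    (hL : HasLieDerivative φ γ L) (hq : Φ.q γ = c • γ + L) :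
    Φ.IsSolution (Φ.scaleInterval c)
      (fun t => Φ.scale c t • γ.pullback (φ (Φ.time c t))) γ where
  isOpen := Φ.isOpen_scaleInterval c
  ordConnected := Φ.ordConnected_scaleInterval c
  zero_mem := Φ.zero_mem_scaleInterval c
  initial := by
    rw [scale_zero, time_zero, hφ.map_zero, TensorField.pullback_one, one_smul]
  mem t ht := Φ.smul_mem _ (Φ.pullback_mem _ hγ _) _ (scale_pos ht)
  smooth := by
    refine TensorField.IsSmoothFamily.smul ?_
      fun t ht => (contDiffAt_scale ht).contDiffWithinAt
    refine ((Φ.smooth γ hγ).isSmoothFamily_const _).pullback (Φ.isOpen_scaleInterval c)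
      fun t ht p => ?_
    exact ContMDiffAt.comp (I' := 𝓘(ℝ, ℝ).prod 𝓘(ℝ, E))
      (f := fun z : ℝ × M => (Φ.time c z.1, z.2)) (t, p) hφ.smooth.contMDiffAt
      (((contDiffAt_time ht).contMDiffAt.comp (t, p)
        (contMDiffAt_fst (I := 𝓘(ℝ, ℝ)) (J := 𝓘(ℝ, E)))).prodMk contMDiffAt_snd)
  hasDeriv t ht p k v β := by
    have hpos := scale_pos ht
    have h1 := (hL.hasDerivAt_pullback hφ.map_add (Φ.time c t) p k v β).comp t (hasDerivAt_time ht)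
    have h2 := (hasDerivAt_scale ht).mul h1
    rw [Φ.scaling _ (Φ.pullback_mem _ hγ _) _ hpos, Φ.equivariant _ hγ, hq]
    refine h2.congr_deriv ?_
    change _ = Φ.scale c t ^ Φ.α * (c * γ.pullback (φ (Φ.time c t)) p k v β +
      L.pullback (φ (Φ.time c t)) p k v β)
    have h3 : Φ.scale c t * Φ.scale c t ^ (Φ.α - 1) = Φ.scale c t ^ Φ.α := by
      rw [Real.rpow_sub_one hpos.ne']; field_simp
    rw [← h3, Function.comp_apply]
    ring

/-- The flow of the soliton field normalizes the automorphism group. -/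
theorem conj_mem_autGroup_of_soliton (hΦ : Φ.HasUniqueHomogeneousSolutions)
    {γ L : TensorField E M r s} (hγ : γ ∈ Φ.Γ) (hhom : IsHomogeneous γ) {c : ℝ}
    {X : ∀ p : M, TangentSpace 𝓘(ℝ, E) p} {φ : ℝ → Diff E M} (hφ : IsCompleteFlow X φ)
    (hL : HasLieDerivative φ γ L) (hq : Φ.q γ = c • γ + L) (u : ℝ) {a : Diff E M}
    (ha : a ∈ autGroup γ) : φ u * a * (φ u)⁻¹ ∈ autGroup γ := by
  obtain ⟨t, ht, rfl⟩ := Φ.exists_time_eq c u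
  have h1 := isSolution_of_soliton hγ hφ hL hq
  have h2 := h1.pullback a
  rw [mem_autGroup.1 ha] at h2
  -- Both solutions start at γ because a^* γ = γ, and both stay homogeneous. Their equality says
  -- that a preserves φ_u^* γ, up to the positive factor `scale` that is cancelled below.
  have h3 := (hΦ γ hγ hhom).2 _ _ _ ⟨h1, fun t _ => (hhom.pullback _).smul _⟩
    ⟨h2, fun t _ => ((hhom.pullback _).smul _).pullback _⟩ ht
  rw [← conj_mem_autGroup_pullback, mem_autGroup]
  simp only [TensorField.pullback_smul] at h3
  exact (smul_right_injective _ (scale_pos ht).ne' h3).symm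

end GeometricFlow

end Solutions

/-! ### Differentials regarded as maps of the model spaces. -/

section ModelDerivative

variable {E E' E'' : Type*} [NormedAddCommGroup E] [NormedSpace ℝ E] [NormedAddCommGroup E']
  [NormedSpace ℝ E'] [NormedAddCommGroup E''] [NormedSpace ℝ E'']
  {M M' M'' : Type*} [TopologicalSpace M] [ChartedSpace E M] [TopologicalSpace M']
  [ChartedSpace E' M'] [TopologicalSpace M''] [ChartedSpace E'' M'']

variable (E E') in
/-- The differential of a map between manifolds, as a map of the model spaces. -/
def modelDeriv (f : M → M') (x : M) : E →L[ℝ] E' := mfderiv 𝓘(ℝ, E) 𝓘(ℝ, E') f x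

theorem modelDeriv_comp {g : M' → M''} {f : M → M'} (x : M)
    (hg : MDifferentiableAt 𝓘(ℝ, E') 𝓘(ℝ, E'') g (f x))
    (hf : MDifferentiableAt 𝓘(ℝ, E) 𝓘(ℝ, E') f x) :
    modelDeriv E E'' (g ∘ f) x = (modelDeriv E' E'' g (f x)).comp (modelDeriv E E' f x) :=
  mfderiv_comp x hg hf

theorem modelDeriv_id (x : M) : modelDeriv E E (id : M → M) x = ContinuousLinearMap.id ℝ E :=
  mfderiv_id

theorem modelDeriv_congr {f g : M → M'} {x : M} (h : f =ᶠ[𝓝 x] g) :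
    modelDeriv E E' f x = modelDeriv E E' g x :=
  h.mfderiv_eq

theorem modelDeriv_comp_eq_id {g : M' → M} {f : M → M'} {x : M} {y : M'} (hy : f x = y)
    (hg : MDifferentiableAt 𝓘(ℝ, E') 𝓘(ℝ, E) g y)
    (hf : MDifferentiableAt 𝓘(ℝ, E) 𝓘(ℝ, E') f x) (h : ∀ᶠ z in 𝓝 x, g (f z) = z) :
    (modelDeriv E' E g y).comp (modelDeriv E E' f x) = ContinuousLinearMap.id ℝ E := by
  subst hy
  rw [← modelDeriv_comp x hg hf, modelDeriv_congr (f := g ∘ f) (g := id) h, modelDeriv_id]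

theorem Diff.modelDeriv_bijective (f : Diff E M) (x : M) :
    Function.Bijective (modelDeriv E E f x) := (f.tangentEquiv x).bijective

/-- The differentials at a point of a smooth family of maps that fix the value at that point
depend smoothly on the parameter. -/
theorem contDiffAt_modelDeriv [IsManifold 𝓘(ℝ, E) ∞ M] [IsManifold 𝓘(ℝ, E') ∞ M']
    {f : ℝ → M → M'} {t₀ : ℝ} {x : M} {y : M'}
    (hf : ContMDiffAt (𝓘(ℝ, ℝ).prod 𝓘(ℝ, E)) 𝓘(ℝ, E') ∞ (fun z : ℝ × M => f z.1 z.2) (t₀, x))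
    (hy : ∀ᶠ t in 𝓝 t₀, f t x = y) : ContDiffAt ℝ ∞ (fun t => modelDeriv E E' (f t) x) t₀ := by
  have h := ContMDiffAt.mfderiv (m := ∞) (n := ∞) (x₀ := t₀) f (fun _ => x) hf contMDiffAt_const
    (by simp)
  rw [contMDiffAt_iff_contDiffAt] at h
  refine h.congr_of_eventuallyEq ?_
  have h0 : f t₀ x = y := hy.self_of_nhds
  filter_upwards [hy] with t ht
  -- As source and target points stay at x and y, both coordinate changes are the identity, and the
  -- differential in tangent coordinates is the differential itself.
  have key := inTangentCoordinates_eq (I := 𝓘(ℝ, E)) (I' := 𝓘(ℝ, E')) (fun _ => x)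
    (fun t => f t x) (fun t => modelDeriv E E' (f t) x) (x₀ := t₀) (x := t)
    (mem_chart_source E x) (by rw [h0, ht]; exact mem_chart_source E' y)
  refine Eq.trans ?_ key.symm
  ext v
  simp only [ContinuousLinearMap.comp_apply, h0, ht]
  rw [(tangentBundleCore 𝓘(ℝ, E) M).coordChange_self _ x (mem_achart_source E x),
    (tangentBundleCore 𝓘(ℝ, E') M').coordChange_self _ y (mem_achart_source E' y)]

theorem finrank_range_comp_comp {V W V' W' : Type*} [AddCommGroup V] [Module ℝ V] [AddCommGroup W]
    [Module ℝ W] [AddCommGroup V'] [Module ℝ V'] [AddCommGroup W'] [Module ℝ W']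
    (A : W →ₗ[ℝ] W') (B : V →ₗ[ℝ] W) (C : V' →ₗ[ℝ] V) (hA : Function.Injective A)
    (hC : Function.Surjective C) :
    Module.finrank ℝ (A ∘ₗ B ∘ₗ C).range = Module.finrank ℝ B.range := by
  rw [LinearMap.range_comp, LinearMap.range_comp_of_range_eq_top _ (LinearMap.range_eq_top.2 hC)]
  exact (LinearEquiv.finrank_eq (Submodule.equivMapOfInjective A hA _)).symm

end ModelDerivative

/-! ### The orbit map of a transitive Lie transformation group. -/

section Orbit

variable {E : Type*} [NormedAddCommGroup E] [NormedSpace ℝ E]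
  {M : Type*} [TopologicalSpace M] [ChartedSpace E M]
  {F : Type*} [NormedAddCommGroup F] [NormedSpace ℝ F]
  {H : Subgroup (Diff E M)} [TopologicalSpace H] [ChartedSpace F H]

theorem IsLieTransformationGroup.contMDiff_orbit
    (hH : IsLieTransformationGroup (F := F) H) (o : M) :
    ContMDiff 𝓘(ℝ, F) 𝓘(ℝ, E) ∞ (fun a : H => (a : Diff E M) o) :=
  hH.smooth_action.comp (contMDiff_id.prodMk contMDiff_const)

variable [LieGroup 𝓘(ℝ, F) ∞ H]

theorem modelDeriv_mul_left_surjective (a : H) :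
    Function.Surjective (modelDeriv F F (fun b : H => a * b) 1) := by
  have h := modelDeriv_comp_eq_id (f := fun b : H => a⁻¹ * b) (g := fun b : H => a * b) (x := a)
    (y := 1) (by simp) ((contMDiff_mul_left (I := 𝓘(ℝ, F)) (n := ∞)).mdifferentiableAt (by simp))
    ((contMDiff_mul_left (I := 𝓘(ℝ, F)) (n := ∞)).mdifferentiableAt (by simp))
    (Eventually.of_forall fun b => by simp)
  exact fun v => ⟨_, congrArg (fun A => A v) h⟩

/-- Equivariance: the orbit map intertwines left translation by a with the diffeomorphism a, and
both have invertible differentials. -/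
theorem IsLieTransformationGroup.finrank_range_orbit (hH : IsLieTransformationGroup (F := F) H)
    (o : M) (a : H) :
    Module.finrank ℝ (modelDeriv F E (fun b : H => (b : Diff E M) o) a).range =
      Module.finrank ℝ (modelDeriv F E (fun b : H => (b : Diff E M) o) 1).range := by
  have horb := hH.contMDiff_orbit o
  have h1 : (fun b : H => (b : Diff E M) o) ∘ (fun b : H => a * b) =
      (a : Diff E M) ∘ (fun b : H => (b : Diff E M) o) := rfl
  have h2 : modelDeriv F E ((fun b : H => (b : Diff E M) o) ∘ (fun b : H => a * b)) 1 =
      modelDeriv F E ((a : Diff E M) ∘ (fun b : H => (b : Diff E M) o)) 1 := by rw [h1]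
  rw [modelDeriv_comp _ (horb.mdifferentiableAt (by simp))
    ((contMDiff_mul_left (I := 𝓘(ℝ, F)) (n := ∞)).mdifferentiableAt (by simp)),
    modelDeriv_comp _ ((a : Diff E M).contMDiff.mdifferentiableAt (by simp))
      (horb.mdifferentiableAt (by simp)), mul_one] at h2
  have h3 := finrank_range_comp_comp (LinearMap.id (R := ℝ) (M := E))
    (modelDeriv F E (fun b : H => (b : Diff E M) o) a : F →ₗ[ℝ] E)
    (modelDeriv F F (fun b : H => a * b) 1 : F →ₗ[ℝ] F) Function.injective_id
    (modelDeriv_mul_left_surjective a)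
  have h4 := finrank_range_comp_comp
    (modelDeriv E E (a : Diff E M) o : E →ₗ[ℝ] E)
    (modelDeriv F E (fun b : H => (b : Diff E M) o) 1 : F →ₗ[ℝ] E) (LinearMap.id (R := ℝ) (M := F))
    (Diff.modelDeriv_bijective _ _).1 Function.surjective_id
  rw [← h3, ← h4]
  have h5 : LinearMap.id (R := ℝ) (M := E) ∘ₗ
      (modelDeriv F E (fun b : H => (b : Diff E M) o) a : F →ₗ[ℝ] E) ∘ₗ
      (modelDeriv F F (fun b : H => a * b) 1 : F →ₗ[ℝ] F) =
      (modelDeriv E E (a : Diff E M) o : E →ₗ[ℝ] E) ∘ₗ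
      (modelDeriv F E (fun b : H => (b : Diff E M) o) 1 : F →ₗ[ℝ] E) ∘ₗ LinearMap.id := by
    ext v
    exact congrArg (fun A => A v) h2
  rw [h5]

variable [FiniteDimensional ℝ E] [IsManifold 𝓘(ℝ, E) ∞ M]

/-- A smooth local section of the orbit map. -/
theorem IsLieTransformationGroup.exists_local_section
    (hH : IsLieTransformationGroup (F := F) H) (o : M)
    (hsurj : Function.Surjective (modelDeriv F E (fun b : H => (b : Diff E M) o) 1)) :
    ∃ σ : M → H, ContMDiffAt 𝓘(ℝ, E) 𝓘(ℝ, F) ∞ σ o ∧ σ o = 1 ∧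
      ∀ᶠ p in 𝓝 o, (σ p : Diff E M) o = p := by
  let orb : H → M := fun b => (b : Diff E M) o
  have horb : ContMDiff 𝓘(ℝ, F) 𝓘(ℝ, E) ∞ orb := hH.contMDiff_orbit o
  set P := modelDeriv F E orb 1 with hP
  obtain ⟨R, hR⟩ := (P : F →ₗ[ℝ] E).exists_rightInverse_of_surjective (LinearMap.range_eq_top.2 hsurj)
  let R' : E →L[ℝ] F := LinearMap.toContinuousLinearMap R
  let e := chartAt F (1 : H)
  let e' := chartAt E o
  have hsource : e 1 ∈ e.target := e.map_source (mem_chart_source F 1)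
  have hsymm : e.symm (e 1) = 1 := e.left_inv (mem_chart_source F 1)
  have h1 : ContMDiffAt 𝓘(ℝ, F) 𝓘(ℝ, F) ∞ e.symm (e 1) :=
    contMDiffOn_chart_symm.contMDiffAt (e.open_target.mem_nhds hsource)
  have h2 : ContMDiffAt 𝓘(ℝ, E) 𝓘(ℝ, E) ∞ e' (orb (e.symm (e 1))) := by
    rw [hsymm]
    exact contMDiffAt_of_mem_maximalAtlas (IsManifold.chart_mem_maximalAtlas o) (mem_chart_source E o)
  let f : F → E := fun x => e' (orb (e.symm x))
  have hfm : ContDiffAt ℝ ∞ f (e 1) :=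
    contMDiffAt_iff_contDiffAt.1 (ContMDiffAt.comp (e 1) h2 (horb.contMDiffAt.comp (e 1) h1))
  have hfd : HasFDerivAt f P (e 1) := by
    have := (horb.mdifferentiableAt (x := 1) (by simp)).hasMFDerivAt.2
    simp only [writtenInExtChartAt, mfld_simps] at this
    exact hasFDerivWithinAt_univ.1 this
  -- On the slice through the identity in the direction of a right inverse of `P`, the orbit map in
  -- charts has derivative the identity; its local inverse yields the section.
  let g : E → E := fun x => f (e 1 + R' x)
  have hg : ContDiffAt ℝ ∞ g 0 := by
    refine ContDiffAt.comp (g := f) (f := fun x => e 1 + R' x) 0 ?_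
      (contDiff_const.add R'.contDiff).contDiffAt
    simpa using hfm
  have hgd : HasFDerivAt g ((ContinuousLinearEquiv.refl ℝ E : E ≃L[ℝ] E) : E →L[ℝ] E) 0 := by
    have a1 : HasFDerivAt f P (e 1 + R' 0) := by simpa using hfd
    refine (a1.comp 0 (R'.hasFDerivAt.const_add (e 1))).congr_fderiv ?_
    ext v
    exact congrArg (fun A => A v) hR
  have hg0 : g 0 = e' o := by
    change e' (orb (e.symm (e 1 + R' 0))) = _
    rw [map_zero, add_zero, hsymm]; rfl
  let G := hg.toOpenPartialHomeomorph g hgd (by simp)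
  have hG0 : (0 : E) ∈ G.source := hg.mem_toOpenPartialHomeomorph_source hgd (by simp)
  have hGs : ContDiffAt ℝ ∞ G.symm (g 0) := hg.to_localInverse hgd (by simp)
  have hGsymm : G.symm (e' o) = 0 := by rw [← hg0]; exact G.left_inv hG0
  have he' : ContMDiffAt 𝓘(ℝ, E) 𝓘(ℝ, E) ∞ e' o :=
    contMDiffAt_of_mem_maximalAtlas (IsManifold.chart_mem_maximalAtlas o) (mem_chart_source E o)
  have hτ : ContMDiffAt 𝓘(ℝ, E) 𝓘(ℝ, F) ∞ (fun p => e 1 + R' (G.symm (e' p))) o := by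
    rw [hg0] at hGs
    exact ((contDiff_const.add R'.contDiff).contDiffAt.comp (e' o) hGs).contMDiffAt.comp o he'
  refine ⟨fun p => e.symm (e 1 + R' (G.symm (e' p))), ?_, ?_, ?_⟩
  · refine ContMDiffAt.comp o ?_ hτ
    simpa [hGsymm] using h1
  · simp [hGsymm, hsymm]
  · have k1 : ∀ᶠ p in 𝓝 o, p ∈ e'.source := e'.open_source.mem_nhds (mem_chart_source E o)
    have k2 : ∀ᶠ p in 𝓝 o, e' p ∈ G.target := by
      refine he'.continuousAt.preimage_mem_nhds (G.open_target.mem_nhds ?_)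
      rw [← hg0]; exact G.map_source hG0
    have k3 : ∀ᶠ p in 𝓝 o, orb (e.symm (e 1 + R' (G.symm (e' p)))) ∈ e'.source := by
      have : ContinuousAt (fun p => orb (e.symm (e 1 + R' (G.symm (e' p))))) o := by
        refine horb.continuous.continuousAt.comp (ContinuousAt.comp ?_ hτ.continuousAt)
        simpa [hGsymm] using h1.continuousAt
      refine this.preimage_mem_nhds (e'.open_source.mem_nhds ?_)
      rw [hGsymm, map_zero, add_zero, hsymm]
      exact mem_chart_source E o
    filter_upwards [k1, k2, k3] with p hp1 hp2 hp3
    exact e'.injOn hp3 hp1 (G.right_inv hp2)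

variable [FiniteDimensional ℝ F] [T2Space M] [SecondCountableTopology H]

/-- The orbit map of a transitive Lie transformation group is a submersion. -/
theorem IsLieTransformationGroup.surjective_modelDeriv_orbit
    (hH : IsLieTransformationGroup (F := F) H) (htrans : ∀ p p' : M, ∃ a : H, (a : Diff E M) p = p')
    (o : M) : Function.Surjective (modelDeriv F E (fun b : H => (b : Diff E M) o) 1) := by
  by_contra hns
  let orb : H → M := fun b => (b : Diff E M) o
  have horb : ContMDiff 𝓘(ℝ, F) 𝓘(ℝ, E) ∞ orb := hH.contMDiff_orbit o
  have : LocallyCompactSpace M := ChartedSpace.locallyCompactSpace E M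
  have : LocallyCompactSpace H := ChartedSpace.locallyCompactSpace F H
  have : IsTopologicalGroup H := topologicalGroup_of_lieGroup 𝓘(ℝ, F) ∞
  have : Nonempty M := ⟨o⟩
  have hlt : Module.finrank ℝ (modelDeriv F E orb 1).range < Module.finrank ℝ E := by
    refine Submodule.finrank_lt fun htop => hns ?_
    exact LinearMap.range_eq_top.1 htop
  -- the orbit map in charts
  let e := chartAt F (1 : H)
  let e' := chartAt E o
  let f : F → E := fun x => e' (orb (e.symm x))
  have hsource : e 1 ∈ e.target := e.map_source (mem_chart_source F 1)
  have hsymm : e.symm (e 1) = 1 := e.left_inv (mem_chart_source F 1)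
  have hfm : ContMDiffAt 𝓘(ℝ, F) 𝓘(ℝ, E) ∞ f (e 1) := by
    have h1 : ContMDiffAt 𝓘(ℝ, F) 𝓘(ℝ, F) ∞ e.symm (e 1) :=
      contMDiffOn_chart_symm.contMDiffAt (e.open_target.mem_nhds hsource)
    have h2 : ContMDiffAt 𝓘(ℝ, E) 𝓘(ℝ, E) ∞ e' (orb (e.symm (e 1))) := by
      rw [hsymm]
      exact contMDiffAt_of_mem_maximalAtlas (IsManifold.chart_mem_maximalAtlas o) (mem_chart_source E o)
    exact ContMDiffAt.comp (e 1) h2 (horb.contMDiffAt.comp (e 1) h1)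
  have hf : ContDiffAt ℝ 1 f (e 1) := (contMDiffAt_iff_contDiffAt.1 hfm).of_le (by simp)
  have hrk : ∀ᶠ x in 𝓝 (e 1), Module.finrank ℝ (fderiv ℝ f x).range =
      Module.finrank ℝ (modelDeriv F E orb 1).range := by
    have h1 : ∀ᶠ x in 𝓝 (e 1), x ∈ e.target := e.open_target.mem_nhds hsource
    have h2 : ∀ᶠ x in 𝓝 (e 1), orb (e.symm x) ∈ e'.source := by
      have : ContinuousAt (fun x => orb (e.symm x)) (e 1) :=
        horb.continuous.continuousAt.comp (e.continuousAt_symm hsource)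
      refine this.preimage_mem_nhds (e'.open_source.mem_nhds ?_)
      rw [hsymm]; exact mem_chart_source E o
    filter_upwards [h1, h2] with x hx1 hx2
    have he := mdifferentiable_chart (I := 𝓘(ℝ, F)) (1 : H)
    have he' := mdifferentiable_chart (I := 𝓘(ℝ, E)) o
    rw [← hH.finrank_range_orbit o (e.symm x)]
    have h3 : fderiv ℝ f x = (modelDeriv E E e' (orb (e.symm x))).comp
        ((modelDeriv F E orb (e.symm x)).comp (modelDeriv F F e.symm x)) := by
      rw [← mfderiv_eq_fderiv]
      change modelDeriv F E (e' ∘ (orb ∘ e.symm)) x = _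
      rw [modelDeriv_comp (E' := E), modelDeriv_comp (E' := F)]
      · rfl
      · exact horb.mdifferentiableAt (by simp)
      · exact he.mdifferentiableAt_symm hx1
      · exact he'.mdifferentiableAt hx2
      · exact (horb.mdifferentiableAt (by simp)).comp x (he.mdifferentiableAt_symm hx1)
    rw [h3]
    refine finrank_range_comp_comp (modelDeriv E E e' (orb (e.symm x)) : E →ₗ[ℝ] E)
      (modelDeriv F E orb (e.symm x) : F →ₗ[ℝ] E) (modelDeriv F F e.symm x : F →ₗ[ℝ] F)
      (he'.mfderiv_bijective hx2).1 (he.symm.mfderiv_surjective hx1)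
  obtain ⟨U, hU, hdim⟩ := exists_nhds_dimH_image_lt hf
    (by filter_upwards [hrk] with x hx; rw [hx, hrk.self_of_nhds])
    (by rw [hrk.self_of_nhds]; exact hlt)
  -- a compact neighbourhood of the identity with small orbit
  have hV : e.source ∩ (e ⁻¹' U ∩ orb ⁻¹' e'.source) ∈ 𝓝 (1 : H) :=
    inter_mem (e.open_source.mem_nhds (mem_chart_source F 1))
      (inter_mem ((e.continuousAt (mem_chart_source F 1)).preimage_mem_nhds hU)
        (horb.continuous.continuousAt.preimage_mem_nhds
          (e'.open_source.mem_nhds (mem_chart_source E o))))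
  obtain ⟨C, hC1, hCV, hCc⟩ := local_compact_nhds hV
  -- A nonempty open set of E has full Hausdorff dimension, whereas `f '' U` does not.
  have hint : ¬ (interior (orb '' C)).Nonempty := by
    rintro ⟨p, hp⟩
    have hsub : orb '' C ⊆ e'.source := by
      rintro _ ⟨a, ha, rfl⟩; exact (hCV ha).2.2
    have hop : IsOpen (e' '' interior (orb '' C)) :=
      e'.isOpen_image_of_subset_source isOpen_interior (interior_subset.trans hsub)
    have h1 : dimH (e' '' interior (orb '' C)) = Module.finrank ℝ E :=
      Real.dimH_of_nonempty_interior (by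
        rw [hop.interior_eq]; exact ⟨_, mem_image_of_mem _ hp⟩)
    have h2 : e' '' interior (orb '' C) ⊆ f '' U := by
      rintro _ ⟨q, hq, rfl⟩
      obtain ⟨a, ha, rfl⟩ := interior_subset hq
      refine ⟨e a, (hCV ha).2.1, ?_⟩
      change e' (orb (e.symm (e a))) = _
      rw [e.left_inv (hCV ha).1]
    exact absurd (dimH_mono h2) (by rw [h1]; exact not_le.2 hdim)
  -- By second countability, countably many translates of `C` cover H; by transitivity the
  -- corresponding translates of its orbit cover M. They are closed and M is a Baire space, so one
  -- has interior, and hence so does the orbit of `C`.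
  obtain ⟨S, hS, hcov⟩ := TopologicalSpace.countable_cover_nhds
    (f := fun a : H => (fun b => a * b) '' C) fun a => by
      have := (Homeomorph.mulLeft a).isOpenMap.image_mem_nhds hC1
      simpa using this
  have : Countable S := hS.to_subtype
  obtain ⟨a, p, hp⟩ := nonempty_interior_of_iUnion_of_closed
    (f := fun a : S => ((a : H) : Diff E M) '' (orb '' C))
    (fun a => ((hCc.image horb.continuous).image ((a : H) : Diff E M).continuous).isClosed) (by
      refine eq_univ_of_forall fun q => ?_
      obtain ⟨b, hb⟩ := htrans o q
      have hb' : b ∈ ⋃ a ∈ S, (fun b => a * b) '' C := by rw [hcov]; trivial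
      simp only [mem_iUnion] at hb'
      obtain ⟨a, ha, c, hc, rfl⟩ := hb'
      exact mem_iUnion.2 ⟨⟨a, ha⟩, orb c, ⟨c, hc, rfl⟩, hb⟩)
  have himg := ((a : H) : Diff E M).toHomeomorph.image_interior (orb '' C)
  change _ = interior (((a : H) : Diff E M) '' (orb '' C)) at himg
  rw [← himg] at hp
  obtain ⟨q, hq, -⟩ := hp
  exact hint ⟨q, hq⟩

end Orbit

/-! ### Automorphisms of the group given by conjugation with the flow. -/

section Conjugation

variable {E : Type*} [NormedAddCommGroup E] [NormedSpace ℝ E]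
  {M : Type*} [TopologicalSpace M] [ChartedSpace E M]
  {H : Subgroup (Diff E M)}

/-- Conjugation of elements of `H` by `φ u`, where `φ u` normalizes `H`. -/
def conjFamily (φ : ℝ → Diff E M) (hφ : ∀ u, ∀ a ∈ H, φ u * a * (φ u)⁻¹ ∈ H) (u : ℝ) (a : H) :
    H := ⟨φ u * a * (φ u)⁻¹, hφ u a a.2⟩

section

variable {φ : ℝ → Diff E M} (hφ : ∀ u, ∀ a ∈ H, φ u * a * (φ u)⁻¹ ∈ H)
  (hinv : ∀ u, (φ u)⁻¹ = φ (-u))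

/-- Conjugation by `b * φ u`, where `b ∈ H` and `φ u` normalizes `H`, as an automorphism of `H`. -/
def conjEquiv (b : H) (u : ℝ) : H ≃* H where
  toFun a := b * conjFamily φ hφ u a * b⁻¹
  invFun a := conjFamily φ hφ (-u) (b⁻¹ * a * b)
  left_inv a := by
    apply Subtype.ext
    change φ (-u) * ((b : Diff E M)⁻¹ * ((b : Diff E M) * (φ u * a * (φ u)⁻¹) * (b : Diff E M)⁻¹) *
      b) * (φ (-u))⁻¹ = a
    rw [← hinv]; group
  right_inv a := by
    apply Subtype.ext
    change (b : Diff E M) * (φ u * (φ (-u) * ((b : Diff E M)⁻¹ * a * b) * (φ (-u))⁻¹) *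
      (φ u)⁻¹) * (b : Diff E M)⁻¹ = a
    rw [← hinv]; group
  map_mul' a a' := by
    apply Subtype.ext
    change (b : Diff E M) * (φ u * (a * a') * (φ u)⁻¹) * (b : Diff E M)⁻¹ =
      ((b : Diff E M) * (φ u * a * (φ u)⁻¹) * (b : Diff E M)⁻¹) *
        ((b : Diff E M) * (φ u * a' * (φ u)⁻¹) * (b : Diff E M)⁻¹)
    group

theorem coe_conjEquiv (b : H) (u : ℝ) (a : H) :
    (conjEquiv hφ hinv b u a : Diff E M) = (b * φ u) * a * (b * φ u)⁻¹ := by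
  change (b : Diff E M) * (φ u * a * (φ u)⁻¹) * (b : Diff E M)⁻¹ = _
  group

/-- For f = b φ_u and its conjugation ψ one has f a = ψ(a) f; evaluate at the fixed point o. -/
theorem conjEquiv_smul (b : H) (u : ℝ) {o : M} (ho : (b * φ u) o = o) (a : H) :
    ((b : Diff E M) * φ u) ((a : Diff E M) o) = (conjEquiv hφ hinv b u a : Diff E M) o := by
  have h : (conjEquiv hφ hinv b u a : Diff E M) * (b * φ u) = (b * φ u) * a := by
    rw [coe_conjEquiv]; group
  have h' := congrArg (fun f : Diff E M => f o) h
  simp only [Diff.mul_apply] at h' ho ⊢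
  rw [ho] at h'
  exact h'.symm

end

variable {m : ℕ} [TopologicalSpace H] [ChartedSpace (EuclideanSpace ℝ (Fin m)) H]

/-- As a family of diffeomorphisms, φ_u a φ_{-u} is visibly smooth in (u, a), being composed of the
flow and the action. In a chart of H it has m + 1 Euclidean parameters (time and the m coordinates
of a), so `smooth_of_family` makes it smooth as a map into H. -/
theorem contMDiff_conjFamily [IsManifold 𝓘(ℝ, EuclideanSpace ℝ (Fin m)) ∞ H]
    (hH : IsLieTransformationGroup (F := EuclideanSpace ℝ (Fin m)) H)
    {φ : ℝ → Diff E M} (hφ : ∀ u, ∀ a ∈ H, φ u * a * (φ u)⁻¹ ∈ H)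
    (hs : ContMDiff (𝓘(ℝ, ℝ).prod 𝓘(ℝ, E)) 𝓘(ℝ, E) ∞ (fun z : ℝ × M => φ z.1 z.2))
    (hinv : ∀ u, (φ u)⁻¹ = φ (-u)) :
    ContMDiff (𝓘(ℝ, ℝ).prod 𝓘(ℝ, EuclideanSpace ℝ (Fin m))) 𝓘(ℝ, EuclideanSpace ℝ (Fin m)) ∞
      (fun z : ℝ × H => conjFamily φ hφ z.1 z.2) := by
  rintro ⟨u₀, a₀⟩
  let F := EuclideanSpace ℝ (Fin m)
  let W := EuclideanSpace ℝ (Fin (m + 1))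
  let e : W ≃L[ℝ] ℝ × F := ContinuousLinearEquiv.ofFinrankEq (by simp [W, F, add_comm])
  let c := chartAt F a₀
  let U : Set W := {w | (e w).2 ∈ c.target}
  have hU : IsOpen U := c.open_target.preimage (continuous_snd.comp e.continuous)
  let h : W → H := fun w => conjFamily φ hφ (e w).1 (c.symm (e w).2)
  have e1 : ContMDiff 𝓘(ℝ, W) 𝓘(ℝ, ℝ) ∞ (fun w => (e w).1) :=
    (contDiff_fst.comp e.contDiff).contMDiff
  have e2 : ContMDiff 𝓘(ℝ, W) 𝓘(ℝ, F) ∞ (fun w => (e w).2) :=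
    (contDiff_snd.comp e.contDiff).contMDiff
  have hfam : ContMDiffOn (𝓘(ℝ, W).prod 𝓘(ℝ, E)) 𝓘(ℝ, E) ∞
      (fun z : W × M => (h z.1 : Diff E M) z.2) (U ×ˢ univ) := by
    have k1 : ContMDiff (𝓘(ℝ, W).prod 𝓘(ℝ, E)) 𝓘(ℝ, E) ∞
        (fun z : W × M => φ (-(e z.1).1) z.2) :=
      hs.comp (I' := 𝓘(ℝ, ℝ).prod 𝓘(ℝ, E)) (f := fun z : W × M => (-(e z.1).1, z.2))
        ((contDiff_neg.contMDiff.comp (e1.comp contMDiff_fst)).prodMk contMDiff_snd)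
    have k2 : ContMDiffOn (𝓘(ℝ, W).prod 𝓘(ℝ, E)) 𝓘(ℝ, F) ∞
        (fun z : W × M => c.symm (e z.1).2) (U ×ˢ univ) :=
      contMDiffOn_chart_symm.comp (e2.comp contMDiff_fst).contMDiffOn fun z hz => hz.1
    have k3 : ContMDiffOn (𝓘(ℝ, W).prod 𝓘(ℝ, E)) 𝓘(ℝ, E) ∞
        (fun z : W × M => (c.symm (e z.1).2 : Diff E M) (φ (-(e z.1).1) z.2)) (U ×ˢ univ) :=
      hH.smooth_action.comp_contMDiffOn (I' := 𝓘(ℝ, F).prod 𝓘(ℝ, E))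
        (f := fun z : W × M => (c.symm (e z.1).2, φ (-(e z.1).1) z.2))
        (k2.prodMk k1.contMDiffOn)
    have k4 := hs.comp_contMDiffOn (I' := 𝓘(ℝ, ℝ).prod 𝓘(ℝ, E))
        (f := fun z : W × M => ((e z.1).1, (c.symm (e z.1).2 : Diff E M) (φ (-(e z.1).1) z.2)))
        (((e1.comp contMDiff_fst).contMDiffOn).prodMk k3)
    refine k4.congr fun z _ => ?_
    change φ _ ((c.symm (e z.1).2 : Diff E M) ((φ _)⁻¹ z.2)) = _
    rw [hinv]
    rfl
  have hh : ContMDiffOn 𝓘(ℝ, W) 𝓘(ℝ, F) ∞ h U := hH.smooth_of_family (m + 1) U h hU hfam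
  have ha₀ : c.symm (c a₀) = a₀ := c.left_inv (mem_chart_source F a₀)
  have hmem : e.symm (u₀, c a₀) ∈ U := by
    change (e (e.symm (u₀, c a₀))).2 ∈ c.target
    rw [e.apply_symm_apply]; exact c.map_source (mem_chart_source F a₀)
  have hj : ContMDiffAt (𝓘(ℝ, ℝ).prod 𝓘(ℝ, F)) 𝓘(ℝ, W) ∞
      (fun z : ℝ × H => e.symm (z.1, c z.2)) (u₀, a₀) := by
    have hc : ContMDiffAt 𝓘(ℝ, F) 𝓘(ℝ, F) ∞ c a₀ :=
      contMDiffAt_of_mem_maximalAtlas (IsManifold.chart_mem_maximalAtlas a₀)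
        (mem_chart_source F a₀)
    have : ContMDiffAt (𝓘(ℝ, ℝ).prod 𝓘(ℝ, F)) 𝓘(ℝ, ℝ × F) ∞
        (fun z : ℝ × H => (z.1, c z.2)) (u₀, a₀) :=
      contMDiffAt_fst.prodMk_space (hc.comp (u₀, a₀) contMDiffAt_snd)
    exact e.symm.contDiff.contMDiff.contMDiffAt.comp _ this
  have := (hh.contMDiffAt (hU.mem_nhds hmem)).comp (u₀, a₀) hj
  refine this.congr_of_eventuallyEq ?_
  have hev : ∀ᶠ z : ℝ × H in 𝓝 (u₀, a₀), z.2 ∈ c.source :=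
    continuousAt_snd.preimage_mem_nhds (c.open_source.mem_nhds (mem_chart_source F a₀))
  filter_upwards [hev] with z hz
  simp only [Function.comp_apply, h, e.apply_symm_apply]
  rw [c.left_inv hz]

variable [LieGroup 𝓘(ℝ, EuclideanSpace ℝ (Fin m)) ∞ H]

theorem contMDiff_conjEquiv
    (hH : IsLieTransformationGroup (F := EuclideanSpace ℝ (Fin m)) H)
    {φ : ℝ → Diff E M} (hφ : ∀ u, ∀ a ∈ H, φ u * a * (φ u)⁻¹ ∈ H)
    (hs : ContMDiff (𝓘(ℝ, ℝ).prod 𝓘(ℝ, E)) 𝓘(ℝ, E) ∞ (fun z : ℝ × M => φ z.1 z.2))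
    (hinv : ∀ u, (φ u)⁻¹ = φ (-u)) (b : H) (u : ℝ) :
    ContMDiff 𝓘(ℝ, EuclideanSpace ℝ (Fin m)) 𝓘(ℝ, EuclideanSpace ℝ (Fin m)) ∞
      (conjEquiv hφ hinv b u) := by
  have h := (contMDiff_conjFamily hH hφ hs hinv).comp
    ((contMDiff_const (c := u)).prodMk (contMDiff_id (M := H)))
  exact (contMDiff_const.mul h).mul contMDiff_const

theorem contMDiff_conjEquiv_symm
    (hH : IsLieTransformationGroup (F := EuclideanSpace ℝ (Fin m)) H)
    {φ : ℝ → Diff E M} (hφ : ∀ u, ∀ a ∈ H, φ u * a * (φ u)⁻¹ ∈ H)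
    (hs : ContMDiff (𝓘(ℝ, ℝ).prod 𝓘(ℝ, E)) 𝓘(ℝ, E) ∞ (fun z : ℝ × M => φ z.1 z.2))
    (hinv : ∀ u, (φ u)⁻¹ = φ (-u)) (b : H) (u : ℝ) :
    ContMDiff 𝓘(ℝ, EuclideanSpace ℝ (Fin m)) 𝓘(ℝ, EuclideanSpace ℝ (Fin m)) ∞
      (conjEquiv hφ hinv b u).symm := by
  have h := (contMDiff_conjFamily hH hφ hs hinv).comp
    ((contMDiff_const (c := -u)).prodMk ((contMDiff_const (c := b⁻¹).mul (contMDiff_id (M := H))).mul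
      (contMDiff_const (c := b))))
  exact h

theorem isEquivariantDiffeo_mul
    (hH : IsLieTransformationGroup (F := EuclideanSpace ℝ (Fin m)) H)
    {φ : ℝ → Diff E M} (hφ : ∀ u, ∀ a ∈ H, φ u * a * (φ u)⁻¹ ∈ H)
    (hs : ContMDiff (𝓘(ℝ, ℝ).prod 𝓘(ℝ, E)) 𝓘(ℝ, E) ∞ (fun z : ℝ × M => φ z.1 z.2))
    (hinv : ∀ u, (φ u)⁻¹ = φ (-u)) (b : H) (u : ℝ) {o : M} (ho : ((b : Diff E M) * φ u) o = o) :
    IsEquivariantDiffeo (F := EuclideanSpace ℝ (Fin m)) H.subtype o (b * φ u) := by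
  refine ⟨conjEquiv hφ hinv b u, contMDiff_conjEquiv hH hφ hs hinv b u,
    contMDiff_conjEquiv_symm hH hφ hs hinv b u, ?_, conjEquiv_smul hφ hinv b u ho⟩
  have key : ∀ a : H, conjEquiv hφ hinv b u a ∈ isotropy H.subtype o ↔
      a ∈ isotropy H.subtype o := fun a => by
    change (conjEquiv hφ hinv b u a : Diff E M) o = o ↔ (a : Diff E M) o = o
    rw [← conjEquiv_smul hφ hinv b u ho]
    exact ⟨fun h => ((b : Diff E M) * φ u).injective (h.trans ho.symm), fun h => by rw [h]; exact ho⟩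
  ext a
  rw [Subgroup.mem_map]
  constructor
  · rintro ⟨x, hx, rfl⟩
    exact (key x).2 hx
  · intro ha
    exact ⟨(conjEquiv hφ hinv b u).symm a, (key _).1 (by simpa using ha), by simp⟩

end Conjugation

/-! ### Lie group automorphisms and the Lie bracket. -/

section Bracket

variable {F : Type*} [NormedAddCommGroup F] [NormedSpace ℝ F]
  {G : Type*} [Group G] [TopologicalSpace G] [ChartedSpace F G]

variable (F G) in
/-- The bracket of the Lie algebra of `G`, on the model space. -/
def modelBracket (v w : F) : F :=
  @Bracket.bracket (GroupLieAlgebra 𝓘(ℝ, F) G) (GroupLieAlgebra 𝓘(ℝ, F) G) inferInstance v w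

theorem modelDeriv_isInvertible {ψ : G ≃* G} (hψ : ContMDiff 𝓘(ℝ, F) 𝓘(ℝ, F) ∞ ψ)
    (hψ' : ContMDiff 𝓘(ℝ, F) 𝓘(ℝ, F) ∞ ψ.symm) (g : G) :
    (modelDeriv F F ψ g).IsInvertible := by
  refine ContinuousLinearMap.IsInvertible.of_inverse (g := modelDeriv F F ψ.symm (ψ g)) ?_ ?_
  · exact modelDeriv_comp_eq_id (by simp) (hψ.mdifferentiableAt (by simp))
      (hψ'.mdifferentiableAt (by simp)) (Eventually.of_forall fun z => ψ.apply_symm_apply z)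
  · exact modelDeriv_comp_eq_id rfl (hψ'.mdifferentiableAt (by simp))
      (hψ.mdifferentiableAt (by simp)) (Eventually.of_forall fun z => ψ.symm_apply_apply z)

variable [LieGroup 𝓘(ℝ, F) ∞ G]

theorem modelDeriv_mulInvariantVectorField {ψ : G ≃* G} (hψ : ContMDiff 𝓘(ℝ, F) 𝓘(ℝ, F) ∞ ψ)
    (v : F) (g : G) :
    modelDeriv F F ψ g (mulInvariantVectorField (I := 𝓘(ℝ, F)) (G := G) v g) =
      mulInvariantVectorField (I := 𝓘(ℝ, F)) (G := G) (modelDeriv F F ψ 1 v) (ψ g) := by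
  have h1 : ψ ∘ (fun b : G => g * b) = (fun b : G => ψ g * b) ∘ ψ := funext fun b => map_mul ψ g b
  have h2 : modelDeriv F F (ψ ∘ (fun b : G => g * b)) 1 =
      modelDeriv F F ((fun b : G => ψ g * b) ∘ ψ) 1 := by rw [h1]
  rw [modelDeriv_comp _ (hψ.mdifferentiableAt (by simp))
    ((contMDiff_mul_left (I := 𝓘(ℝ, F)) (n := ∞)).mdifferentiableAt (by simp)),
    modelDeriv_comp _ ((contMDiff_mul_left (I := 𝓘(ℝ, F)) (n := ∞)).mdifferentiableAt (by simp))
      (hψ.mdifferentiableAt (by simp)), mul_one, map_one] at h2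
  exact congrArg (fun A => A v) h2

/-- An automorphism intertwines left translations, so it permutes left-invariant fields; naturality
of the bracket of vector fields then applies. -/
theorem mpullback_mulInvariantVectorField_mulEquiv {ψ : G ≃* G}
    (hψ : ContMDiff 𝓘(ℝ, F) 𝓘(ℝ, F) ∞ ψ) (hψ' : ContMDiff 𝓘(ℝ, F) 𝓘(ℝ, F) ∞ ψ.symm) (v : F) :
    mpullback 𝓘(ℝ, F) 𝓘(ℝ, F) ψ
      (mulInvariantVectorField (I := 𝓘(ℝ, F)) (G := G) (modelDeriv F F ψ 1 v)) =
      mulInvariantVectorField (I := 𝓘(ℝ, F)) (G := G) v := by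
  ext g
  have h := modelDeriv_mulInvariantVectorField hψ v g
  change (modelDeriv F F ψ g).inverse _ = _
  rw [← h]
  exact (modelDeriv_isInvertible hψ hψ' g).inverse_apply_self _

variable [CompleteSpace F]

/-- The differential at the identity of an automorphism of a Lie group preserves the bracket. -/
theorem modelDeriv_modelBracket {ψ : G ≃* G} (hψ : ContMDiff 𝓘(ℝ, F) 𝓘(ℝ, F) ∞ ψ)
    (hψ' : ContMDiff 𝓘(ℝ, F) 𝓘(ℝ, F) ∞ ψ.symm) (v w : F) :
    modelDeriv F F ψ 1 (modelBracket F G v w) =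
      modelBracket F G (modelDeriv F F ψ 1 v) (modelDeriv F F ψ 1 w) := by
  have : LieGroup 𝓘(ℝ, F) (minSmoothness ℝ 3) G := LieGroup.of_le (n := ∞) (by
    rw [minSmoothness_of_isRCLikeNormedField]; exact ENat.LEInfty.out)
  have h := mpullback_mlieBracket (n := ∞) (I := 𝓘(ℝ, F)) (I' := 𝓘(ℝ, F)) (f := ψ) (x₀ := (1 : G))
    (mdifferentiable_mulInvariantVectorField (I := 𝓘(ℝ, F)) (G := G) (modelDeriv F F ψ 1 v) (ψ 1))
    (mdifferentiable_mulInvariantVectorField (I := 𝓘(ℝ, F)) (G := G) (modelDeriv F F ψ 1 w) (ψ 1))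
    hψ.contMDiffAt (by rw [minSmoothness_of_isRCLikeNormedField]; exact ENat.LEInfty.out)
  rw [mpullback_mulInvariantVectorField_mulEquiv hψ hψ',
    mpullback_mulInvariantVectorField_mulEquiv hψ hψ'] at h
  change (modelDeriv F F ψ 1).inverse _ = modelBracket F G v w at h
  -- Values at `ψ 1` and at `1` lie in different tangent spaces; reading them in F allows rewriting
  -- `ψ 1 = 1`.
  let b : G → F := fun g => mlieBracket 𝓘(ℝ, F)
    (mulInvariantVectorField (I := 𝓘(ℝ, F)) (G := G) (modelDeriv F F ψ 1 v))
    (mulInvariantVectorField (I := 𝓘(ℝ, F)) (G := G) (modelDeriv F F ψ 1 w)) g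
  have hb : b (ψ 1) = b 1 := by rw [map_one]
  rw [← h]
  exact ((modelDeriv_isInvertible hψ hψ' 1).self_apply_inverse (b (ψ 1))).trans hb

variable (F G) in
/-- The bracket as a bilinear map. -/
theorem exists_continuousLinearMap_modelBracket [FiniteDimensional ℝ F] :
    ∃ B : F →L[ℝ] F →L[ℝ] F, ∀ v w, B v w = modelBracket F G v w := by
  have : LieGroup 𝓘(ℝ, F) (minSmoothness ℝ 3) G := LieGroup.of_le (n := ∞) (by
    rw [minSmoothness_of_isRCLikeNormedField]; exact ENat.LEInfty.out)
  let b : F →ₗ[ℝ] F →ₗ[ℝ] F := LinearMap.mk₂ ℝ (modelBracket F G)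
    (fun u v w => add_lie (L := GroupLieAlgebra 𝓘(ℝ, F) G) (M := GroupLieAlgebra 𝓘(ℝ, F) G) u v w)
    (fun c v w => smul_lie (L := GroupLieAlgebra 𝓘(ℝ, F) G) (M := GroupLieAlgebra 𝓘(ℝ, F) G) c v w)
    (fun u v w => lie_add (L := GroupLieAlgebra 𝓘(ℝ, F) G) (M := GroupLieAlgebra 𝓘(ℝ, F) G) u v w)
    (fun c v w => lie_smul (L := GroupLieAlgebra 𝓘(ℝ, F) G) (M := GroupLieAlgebra 𝓘(ℝ, F) G) c v w)
  exact ⟨LinearMap.toContinuousLinearMap ((LinearMap.toContinuousLinearMap :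
    (F →ₗ[ℝ] F) ≃ₗ[ℝ] F →L[ℝ] F).toLinearMap ∘ₗ b), fun v w => rfl⟩

/-- The derivative at the identity of a family of automorphisms is a derivation. -/
theorem modelBracket_derivation [FiniteDimensional ℝ F] {L : ℝ → F →L[ℝ] F} {D : F →L[ℝ] F}
    (hL : HasDerivAt L D 0) (hL0 : ∀ v, L 0 v = v)
    (hbr : ∀ᶠ t in 𝓝 0, ∀ v w, L t (modelBracket F G v w) = modelBracket F G (L t v) (L t w))
    (v w : F) :
    D (modelBracket F G v w) = modelBracket F G (D v) w + modelBracket F G v (D w) := by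
  obtain ⟨B, hB⟩ := exists_continuousLinearMap_modelBracket F G
  have h0 : ∀ v, HasDerivAt (fun t => L t v) (D v) 0 := fun v => by
    simpa using hL.clm_apply (hasDerivAt_const 0 v)
  have h1 : HasDerivAt (fun t => B (L t v) (L t w)) (B (D v) (L 0 w) + B (L 0 v) (D w)) 0 := by
    have : HasDerivAt (fun t => B (L t v)) (B (D v)) 0 := by
      simpa using (hasDerivAt_const (0 : ℝ) B).clm_apply (h0 v)
    exact this.clm_apply (h0 w)
  have h2 : HasDerivAt (fun t => B (L t v) (L t w)) (D (modelBracket F G v w)) 0 := by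
    refine (h0 _).congr_of_eventuallyEq ?_
    filter_upwards [hbr] with t ht
    rw [ht, hB]
  simpa [hL0, hB] using h2.unique h1

theorem modelBracket_derivation_neg [FiniteDimensional ℝ F] {D : F →L[ℝ] F}
    (hD : ∀ v w, D (modelBracket F G v w) = modelBracket F G (D v) w + modelBracket F G v (D w))
    (v w : F) : (-D) (modelBracket F G v w) =
      modelBracket F G ((-D) v) w + modelBracket F G v ((-D) w) := by
  obtain ⟨B, hB⟩ := exists_continuousLinearMap_modelBracket F G
  have h := hD v w
  simp only [← hB] at h ⊢
  simp [h, add_comm]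

end Bracket

/-! ### Signs in θ and the derivative of the inverse. -/

section Theta

variable {V : Type*} [AddCommGroup V] [Module ℝ V] {r s : ℕ}

theorem Tensor.theta_neg (A : V →ₗ[ℝ] V) (T : Tensor r s V) (v : Fin r → V)
    (β : Fin s → Module.Dual ℝ V) : Tensor.theta (-A) T v β = -Tensor.theta A T v β := by
  have h1 : ∀ j, T v (Function.update β j (β j ∘ₗ (-A))) =
      -T v (Function.update β j (β j ∘ₗ A)) := fun j => by
    rw [← neg_one_smul ℝ (T v _), ← MultilinearMap.map_update_smul, neg_one_smul, LinearMap.comp_neg]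
  have h2 : ∀ i, T (Function.update v i ((-A) (v i))) β =
      -T (Function.update v i (A (v i))) β := fun i => by
    rw [LinearMap.neg_apply, ← neg_one_smul ℝ (A (v i)), MultilinearMap.map_update_smul,
      neg_one_smul]
    rfl
  simp only [Tensor.theta, h1, h2, Finset.sum_neg_distrib]
  ring

end Theta

section InverseFamily

variable {E : Type*} [NormedAddCommGroup E] [NormedSpace ℝ E] [FiniteDimensional ℝ E]

/-- Differentiate B⁻¹ B = id, which holds near t because invertibility is an open condition. -/
theorem hasDerivAt_inverse_of_eq_id {B : ℝ → E →L[ℝ] E} {A : E →L[ℝ] E} {t : ℝ}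
    (hB : HasDerivAt B A t) (h1 : B t = ContinuousLinearMap.id ℝ E) :
    HasDerivAt (fun u => (B u).inverse) (-A) t := by
  have : CompleteSpace E := FiniteDimensional.complete ℝ E
  have h2 : DifferentiableAt ℝ ContinuousLinearMap.inverse (B t) := by
    rw [h1]
    exact (contDiffAt_map_inverse (n := 1) (ContinuousLinearEquiv.refl ℝ E)).differentiableAt
      (by simp)
  have h3 : HasDerivAt (fun u => (B u).inverse) _ t := h2.hasFDerivAt.comp_hasDerivAt t hB
  have h4 := h3.clm_comp hB
  have hinv : ∀ᶠ u in 𝓝 t, (B u).IsInvertible := by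
    have : ∀ᶠ T in 𝓝 (B t), T.IsInvertible := by
      rw [h1]; exact ContinuousLinearEquiv.nhds (ContinuousLinearEquiv.refl ℝ E)
    exact hB.continuousAt.tendsto.eventually this
  have h5 : HasDerivAt (fun u => (B u).inverse.comp (B u)) 0 t := by
    refine (hasDerivAt_const t (ContinuousLinearMap.id ℝ E)).congr_of_eventuallyEq ?_
    filter_upwards [hinv] with u hu
    exact hu.inverse_comp_self
  have h6 := h4.unique h5
  refine h3.congr_deriv (eq_neg_of_add_eq_zero_left ?_)
  rw [h1] at h6 ⊢
  simpa using h6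

end InverseFamily

/-! ### The derivation attached to a normalizing flow. -/

section AlgebraicEquation

variable {E : Type*} [NormedAddCommGroup E] [NormedSpace ℝ E]
  {M : Type*} [TopologicalSpace M] [ChartedSpace E M]
  {ι : Type*} {r s : ι → ℕ}

/-- The value of a tensor field at `p`, as a tensor on the model space. -/
def TensorField.modelTensor (γ : TensorField E M r s) (p : M) (k : ι) : Tensor (r k) (s k) E :=
  γ p k

theorem TensorField.pullback_apply_eq (γ : TensorField E M r s) (f : Diff E M) {o p : M}
    (hp : f o = p) (k : ι) (v : Fin (r k) → E) (β : Fin (s k) → Module.Dual ℝ E) :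
    (γ.pullback f).modelTensor o k v β =
      γ.modelTensor p k (fun i => modelDeriv E E f o (v i))
        (fun j => β j ∘ₗ ((modelDeriv E E f o).inverse : E →ₗ[ℝ] E)) := by
  subst hp
  let e : E ≃L[ℝ] E := f.mfderivToContinuousLinearEquiv (by simp) o
  have he : modelDeriv E E f o = (e : E →L[ℝ] E) := rfl
  rw [he, ContinuousLinearMap.inverse_equiv]
  rfl

variable [FiniteDimensional ℝ E]

/-- If `f u` is a family of diffeomorphisms fixing `o`, then the derivative of `(f u)^* γ` at `o`
is given by the infinitesimal action of the derivative of the isotropy representation. -/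
theorem hasDerivAt_pullback_of_fixed (γ : TensorField E M r s) {f : ℝ → Diff E M} {o : M}
    {A : E →L[ℝ] E} (hfix : ∀ᶠ u in 𝓝 0, f u o = o) (h0 : f 0 = 1)
    (hA : HasDerivAt (fun u => modelDeriv E E (f u) o) (-A) 0) (k : ι) (v : Fin (r k) → E)
    (β : Fin (s k) → Module.Dual ℝ E) :
    HasDerivAt (fun u => (γ.pullback (f u)).modelTensor o k v β)
      (Tensor.theta (A : E →ₗ[ℝ] E) (γ.modelTensor o k) v β) 0 := by
  have h1 : modelDeriv E E (f 0) o = ContinuousLinearMap.id ℝ E := by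
    rw [h0]; exact modelDeriv_id o
  have h2 := Tensor.hasDerivAt_pullback (γ.modelTensor o k) hA
    (hasDerivAt_inverse_of_eq_id hA h1) (fun w => by rw [h1]; rfl)
    (fun w => by rw [h1, ContinuousLinearMap.inverse_id]; rfl) v β
  rw [ContinuousLinearMap.toLinearMap_neg, Tensor.theta_neg, neg_neg] at h2
  refine h2.congr_of_eventuallyEq ?_
  filter_upwards [hfix] with u hu
  exact TensorField.pullback_apply_eq γ (f u) hu k v β

variable {m : ℕ} {H : Subgroup (Diff E M)} [TopologicalSpace H]
  [ChartedSpace (EuclideanSpace ℝ (Fin m)) H]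
  [LieGroup 𝓘(ℝ, EuclideanSpace ℝ (Fin m)) ∞ H] [IsManifold 𝓘(ℝ, E) ∞ M]

/-- A flow normalizing a Lie transformation group whose orbit map is a submersion can be corrected
by elements of the group to fix the base point; the derivatives of the induced automorphisms
and of the isotropy action are a derivation and the operator induced by it. -/
theorem exists_derivation_of_normalizing_flow
    (hH : IsLieTransformationGroup (F := EuclideanSpace ℝ (Fin m)) H)
    {φ : ℝ → Diff E M} (hφ : ∀ u, ∀ a ∈ H, φ u * a * (φ u)⁻¹ ∈ H)
    (hs : ContMDiff (𝓘(ℝ, ℝ).prod 𝓘(ℝ, E)) 𝓘(ℝ, E) ∞ (fun z : ℝ × M => φ z.1 z.2))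
    (hinv : ∀ u, (φ u)⁻¹ = φ (-u)) (h0 : φ 0 = 1) (o : M)
    (hsurj : Function.Surjective
      (modelDeriv (EuclideanSpace ℝ (Fin m)) E (fun b : H => (b : Diff E M) o) 1)) :
    ∃ (b : ℝ → H) (D : EuclideanSpace ℝ (Fin m) →L[ℝ] EuclideanSpace ℝ (Fin m)) (A : E →L[ℝ] E),
      b 0 = 1 ∧ (∀ᶠ u in 𝓝 0, ((b u : Diff E M) * φ u) o = o) ∧
      HasDerivAt (fun u => modelDeriv E E ((b u : Diff E M) * φ u) o) (-A) 0 ∧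
      (∀ v w, D (modelBracket (EuclideanSpace ℝ (Fin m)) H v w) =
        modelBracket (EuclideanSpace ℝ (Fin m)) H (D v) w +
          modelBracket (EuclideanSpace ℝ (Fin m)) H v (D w)) ∧
      ∀ v, A (modelDeriv (EuclideanSpace ℝ (Fin m)) E (fun b : H => (b : Diff E M) o) 1 v) =
        modelDeriv (EuclideanSpace ℝ (Fin m)) E (fun b : H => (b : Diff E M) o) 1 (D v) := by
  let F := EuclideanSpace ℝ (Fin m)
  let orb : H → M := fun b => (b : Diff E M) o
  have horb : ContMDiff 𝓘(ℝ, F) 𝓘(ℝ, E) ∞ orb := hH.contMDiff_orbit o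
  set P := modelDeriv F E orb 1 with hP
  obtain ⟨σ, hσ, hσo, hσs⟩ := hH.exists_local_section o hsurj
  -- The section sends φ_u(o) to an element carrying o there; its inverse carries φ_u(o) back.
  let b : ℝ → H := fun u => (σ (φ u o))⁻¹
  have hφ0 : φ 0 o = o := by rw [h0]; rfl
  have hcurve : ContMDiffAt 𝓘(ℝ, ℝ) 𝓘(ℝ, E) ∞ (fun u => φ u o) 0 :=
    hs.contMDiffAt.comp (I' := 𝓘(ℝ, ℝ).prod 𝓘(ℝ, E)) (f := fun u : ℝ => (u, o)) 0
      (contMDiffAt_id.prodMk contMDiffAt_const)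
  have hb : ContMDiffAt 𝓘(ℝ, ℝ) 𝓘(ℝ, F) ∞ b 0 :=
    (ContMDiffAt.comp (g := σ) (0 : ℝ) (by rw [hφ0]; exact hσ) hcurve).inv
  have hb0 : b 0 = 1 := by simp [b, hφ0, hσo]
  have hfix : ∀ᶠ u in 𝓝 (0 : ℝ), ((b u : Diff E M) * φ u) o = o := by
    have : Tendsto (fun u => φ u o) (𝓝 0) (𝓝 o) := by
      have := hcurve.continuousAt.tendsto; rwa [hφ0] at this
    filter_upwards [this.eventually hσs] with u hu
    change (σ (φ u o) : Diff E M).symm (φ u o) = o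
    exact (congrArg (σ (φ u o) : Diff E M).symm hu.symm).trans
      ((σ (φ u o) : Diff E M).symm_apply_apply o)
  let f : ℝ → Diff E M := fun u => b u * φ u
  have hf : ContMDiffAt (𝓘(ℝ, ℝ).prod 𝓘(ℝ, E)) 𝓘(ℝ, E) ∞ (fun z : ℝ × M => f z.1 z.2) (0, o) :=
    hH.smooth_action.contMDiffAt.comp (I' := 𝓘(ℝ, F).prod 𝓘(ℝ, E))
      (f := fun z : ℝ × M => (b z.1, φ z.1 z.2)) (0, o)
      ((hb.comp (I' := 𝓘(ℝ, ℝ)) (f := fun z : ℝ × M => z.1) (0, o) contMDiffAt_fst).prodMk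
        hs.contMDiffAt)
  have hB := ((contDiffAt_modelDeriv (f := fun u p => f u p) hf hfix).differentiableAt
    (by simp)).hasDerivAt
  let Ψ : ℝ → H ≃* H := fun u => conjEquiv hφ hinv (b u) u
  have hΨ : ContMDiffAt (𝓘(ℝ, ℝ).prod 𝓘(ℝ, F)) 𝓘(ℝ, F) ∞ (fun z : ℝ × H => Ψ z.1 z.2) (0, 1) := by
    have hb' := hb.comp (I' := 𝓘(ℝ, ℝ)) (f := fun z : ℝ × H => z.1) (0, 1)
      (contMDiffAt_fst (I := 𝓘(ℝ, ℝ)) (J := 𝓘(ℝ, F)))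
    exact (hb'.mul (contMDiff_conjFamily hH hφ hs hinv).contMDiffAt).mul hb'.inv
  have hL := ((contDiffAt_modelDeriv (f := fun u a => Ψ u a) hΨ
    (Eventually.of_forall fun u => map_one (Ψ u))).differentiableAt (by simp)).hasDerivAt
  set A := deriv (fun u => modelDeriv E E (f u) o) 0
  set D := deriv (fun u => modelDeriv F F (Ψ u) 1) 0
  -- Both derivatives change sign because pulling back differentiates to minus θ of the derivative
  -- of the differentials.
  refine ⟨b, -D, -A, hb0, hfix, by rw [neg_neg]; exact hB, ?_, ?_⟩
  · have hder : ∀ v w, D (modelBracket F H v w) =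
        modelBracket F H (D v) w + modelBracket F H v (D w) := by
      refine modelBracket_derivation hL (fun v => ?_) (Eventually.of_forall fun u v w =>
        modelDeriv_modelBracket (contMDiff_conjEquiv hH hφ hs hinv (b u) u)
        (contMDiff_conjEquiv_symm hH hφ hs hinv (b u) u) v w)
      have : (Ψ 0 : H → H) = id := funext fun a => by
        apply Subtype.ext
        rw [coe_conjEquiv, hb0, h0]
        change (1 * 1 * (a : Diff E M) * (1 * 1)⁻¹ : Diff E M) = a
        group
      change modelDeriv F F (Ψ 0) 1 v = v
      rw [this, modelDeriv_id]
      rfl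
    exact modelBracket_derivation_neg hder
  · intro v
    have h1 : HasDerivAt (fun u => modelDeriv E E (f u) o (P v)) (A (P v)) 0 := by
      simpa using hB.clm_apply (hasDerivAt_const 0 (P v))
    have h2 : HasDerivAt (fun u => P (modelDeriv F F (Ψ u) 1 v)) (P (D v)) 0 := by
      have h3 : HasDerivAt (fun u => modelDeriv F F (Ψ u) 1 v) (D v) 0 := by
        simpa using hL.clm_apply (hasDerivAt_const 0 v)
      exact P.hasFDerivAt.comp_hasDerivAt 0 h3
    rw [neg_apply, neg_apply, map_neg, neg_inj]
    refine h1.unique (h2.congr_of_eventuallyEq ?_)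
    filter_upwards [hfix] with u hu
    -- The differential of this identity at 1, differentiated in u at 0, is A P = P D.
    have h4 : (f u : M → M) ∘ orb = orb ∘ Ψ u := funext fun a => conjEquiv_smul hφ hinv (b u) u hu a
    have h5 : modelDeriv F E ((f u : M → M) ∘ orb) 1 = modelDeriv F E (orb ∘ Ψ u) 1 := by rw [h4]
    rw [modelDeriv_comp (E' := E) _ ((f u).contMDiff.mdifferentiableAt (by simp))
      (horb.mdifferentiableAt (by simp)), modelDeriv_comp (E' := F) _ (horb.mdifferentiableAt (by simp))
      ((contMDiff_conjEquiv hH hφ hs hinv (b u) u).mdifferentiableAt (by simp)), map_one] at h5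
    exact congrArg (fun T => T v) h5

end AlgebraicEquation

end HomSoliton

end

/-! ### Assembly of the theorem. -/

theorem corollary5p4
    {E : Type*} [NormedAddCommGroup E] [NormedSpace ℝ E] [FiniteDimensional ℝ E]
    {M : Type*} [TopologicalSpace M] [T2Space M] [SecondCountableTopology M]
    [ChartedSpace E M] [IsManifold 𝓘(ℝ, E) ∞ M]
    {ι : Type*} [Finite ι] {r s : ι → ℕ}
    (Φ : HomSoliton.GeometricFlow E M r s)
    (hΦ : Φ.HasUniqueHomogeneousSolutions)
    (γ : HomSoliton.TensorField E M r s) (hγ : γ ∈ Φ.Γ)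
    (hhom : HomSoliton.IsHomogeneous γ)
    (hsol : Φ.IsSoliton γ)
    {m : ℕ}
    [TopologicalSpace (HomSoliton.autGroup γ)]
    [SecondCountableTopology (HomSoliton.autGroup γ)]
    [ChartedSpace (EuclideanSpace ℝ (Fin m)) (HomSoliton.autGroup γ)]
    [LieGroup 𝓘(ℝ, EuclideanSpace ℝ (Fin m)) ∞ (HomSoliton.autGroup γ)]
    (hAut : HomSoliton.IsLieTransformationGroup (F := EuclideanSpace ℝ (Fin m))
      (HomSoliton.autGroup γ))
    (o : M) :
    HomSoliton.IsPresentation (F := EuclideanSpace ℝ (Fin m))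
      (HomSoliton.autGroup γ).subtype o ∧
    Φ.IsSemiAlgebraicSoliton (F := EuclideanSpace ℝ (Fin m))
      (HomSoliton.autGroup γ).subtype o γ := by

  obtain ⟨c, X, φ, L, hφ, hL, hq⟩ := hsol
  have hnorm : ∀ u, ∀ a ∈ HomSoliton.autGroup γ, φ u * a * (φ u)⁻¹ ∈ HomSoliton.autGroup γ :=
    fun u a ha => HomSoliton.GeometricFlow.conj_mem_autGroup_of_soliton hΦ hγ hhom hφ hL hq u ha
  have hinv : ∀ u, (φ u)⁻¹ = φ (-u) := fun u => by
    rw [inv_eq_iff_mul_eq_one, ← hφ.map_add, add_neg_cancel, hφ.map_zero]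
  have htrans : ∀ p p' : M, ∃ a : HomSoliton.autGroup γ, (a : HomSoliton.Diff E M) p = p' :=
    fun p p' => by
      obtain ⟨f, hf, hp⟩ := hhom p p'
      exact ⟨⟨f, hf⟩, hp⟩
  have hsurj := hAut.surjective_modelDeriv_orbit htrans o
  refine ⟨⟨hAut.smooth_action, htrans o, hsurj⟩, c, ?_, ?_⟩
  · obtain ⟨b, D, A, hb0, hfix, hA, hder, hind⟩ :=
      HomSoliton.exists_derivation_of_normalizing_flow hAut hnorm hφ.smooth hinv hφ.map_zero o hsurj
    refine ⟨(D : EuclideanSpace ℝ (Fin m) →ₗ[ℝ] EuclideanSpace ℝ (Fin m)), (A : E →ₗ[ℝ] E),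
      ⟨hder, fun Z hZ => ?_⟩, hind, fun k v β => ?_⟩
    -- Since 𝔨 is the kernel of dπ, the relation A dπ = dπ D forces D 𝔨 ⊆ 𝔨.
    · exact (hind Z).symm.trans ((congrArg A hZ).trans (map_zero A))
    · have h1 := hL o k v β
      have h2 := HomSoliton.hasDerivAt_pullback_of_fixed γ hfix
        (by rw [hb0, hφ.map_zero]; rfl) hA k v β
      -- The correction by automorphisms of γ is invisible on γ, so the Lie derivative can be
      -- computed with maps fixing o.
      have h3 : ∀ u, γ.pullback ((b u : HomSoliton.Diff E M) * φ u) = γ.pullback (φ u) := fun u => by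
        rw [HomSoliton.TensorField.pullback_mul, HomSoliton.mem_autGroup.1 (b u).2]
      simp only [h3] at h2
      have h4 := h1.unique h2
      rw [hq]
      change c * γ o k v β + L o k v β = _
      rw [h4]
      rfl
  -- The local section serves only u near 0; here all u are needed but no regularity of b, so
  -- transitivity suffices.
  · choose b hb using fun u => htrans (φ u o) o
    refine ⟨_, fun t => b (Φ.time c t) * φ (Φ.time c t),
      HomSoliton.GeometricFlow.isSolution_of_soliton hγ hφ hL hq, fun t ht => ⟨fun a => ?_, ?_, ?_⟩⟩
    · have h := HomSoliton.conj_mem_autGroup_pullback.2 (hnorm (Φ.time c t) a a.2)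
      rw [HomSoliton.TensorField.pullback_smul]
      exact congrArg _ h
    · exact HomSoliton.isEquivariantDiffeo_mul hAut hnorm hφ.smooth hinv _ _ (hb _)
    · rw [HomSoliton.TensorField.pullback_mul, HomSoliton.mem_autGroup.1 (b _).2]
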